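/- Let $\mathbb F$ be a field of characteristic $0$, let $m\ge 1$, $n=2m+1$, let $c\in\mathbb F$ and $S\subseteq\{1,\dots,n\}$. Let $\mathscr A=\mathbb F[x_1,\dots,x_n]$ and, for $\vec a\in\mathbb F^n$, let $\mathscr A_{\vec a}=\{fe^{\vec a\cdot\vec x}\mid f\in\mathscr A\}$, on which $x_i$ acts by multiplication and $\partial_{x_i}$ by $\partial_{x_i}(fe^{\vec a\cdot\vec x})=(\partial_{x_i}f+a_if)e^{\vec a\cdot\vec x}$. With $D=\sum_{s=1}^nx_s\partial_{x_s}$, the Lie algebra $sl(n+1,\mathbb F)$ is represented by $$E_{i,j}\mapsto x_i\partial_{x_j}\ (i\ne j),\quad E_{i,n+1}\mapsto x_i(D+c),\quad E_{n+1,i}\mapsto-\partial_{x_i},$$ $$E_{i,i}-E_{j,j}\mapsto x_i\partial_{x_i}-x_j\partial_{x_j},\quad E_{n,n}-E_{n+1,n+1}\mapsto D+c+x_n\partial_{x_n}\qquad(1\le i,j\le n).$$ Replacing $\partial_{x_r}$ by $-x_r$ and $x_r$ by $\partial_{x_r}$ for all $r\in S$ (keeping the order of the factors, also in $D$) gives a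 representation $\pi_{c,S}^{\vec a}$ of $sl(n+1,\mathbb F)$ on $\mathscr A_{\vec a}$. Restrict it to $sp(2m+2,\mathbb F)\subset sl(2m+2,\mathbb F)$, the Lie algebra of the block matrices $\begin{pmatrix}A&B\\C&-A^t\end{pmatrix}$ with blocks of size $m+1$ and $B,C$ symmetric. Its diagonal matrices form a Cartan subalgebra $H$; let $\varepsilon_i\in H^*$ be given by $\varepsilon_i(E_{j,j}-E_{m+1+j,m+1+j})=\delta_{i,j}$, and put $\delta_1=-\varepsilon_{m+1}$ and $\delta_k=\varepsilon_{m+2-k}$ for $2\le k\le m+1$. Weights and highest weights refer to $H$ and to the simple roots $\delta_1-\delta_2,\dots,\delta_m-\delta_{m+1},2\delta_{m+1}$; the fundamental weights are $\lambda_i=\delta_1+\dots+\delta_i$. Assume that $m+1\notin S$ and that, for every $i\in\{1,\dots,m\}$, at most one of $i$ and $m+1+i$ lies in $S$. Then: (1) If $c\notin-\mathbb N$ (where $0\in\mathbb N$), the $sp(2m+2,\mathbb F)$-module $\mathscr A$ given by $\pi_{c,\emptyset}^{\vec 0}$ is irreducible, and it is a highest-weight module with highest weight $-c\lambda_1$.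 (2) If $c=-\ell$ with $\ell\in\mathbb N$, then for $\pi_{c,\emptyset}^{\vec 0}$ the polynomials of degree at most $\ell$ form a finite-dimensional irreducible submodule $\mathscr A_{(\ell)}$ of $\mathscr A$ with highest weight $\ell\lambda_1$, and $\mathscr A/\mathscr A_{(\ell)}$ is an irreducible highest-weight module with highest weight $-(\ell+2)\lambda_1+(\ell+1)\lambda_2$. In particular $\mathscr A$ has a composition series of length $2$. (3) If $S\ne\emptyset$ and $c\notin\mathbb Z$, the $sp(2m+2,\mathbb F)$-module $\mathscr A$ given by $\pi_{c,S}^{\vec 0}$ is irreducible. (4) Let $\vec a\ne\vec 0$ with $a_{m+1}=0$. Suppose that, if $S\cap\{m+2,\dots,2m+1\}\ne\emptyset$, then $a_{i}\ne0$ for some $i$ with $m+1+i\in S\cap\{m+2,\dots,2m+1\}$, and that, if $S\cap\{1,\dots,m+1\}\ne\emptyset$, then $a_{m+1+j}\neq0$ for some $j\in S\cap\{1,\dots,m+1\}$. Then the $sp(2m+2,\mathbb F)$-module $\mathscr A_{\vec a}$ given by $\pi_{c,S}^{\vec a}$ is irreducible for every $c\in\mathbb F$. (5) For every $c\in\mathbb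 F$, the $sp(2m+2,\mathbb F)$-module $\mathscr A$ given by $\pi_{c,S}^{\vec 0}$ is an infinite-dimensional weight module (it is the direct sum of its weight subspaces) with finite-dimensional weight subspaces. -/

import Mathlib

open MvPolynomial

namespace ProjOsc

attribute [local instance 100] LieRing.ofAssociativeRing

section SpecialLinear

variable {F : Type*} [Field F] {n : ℕ}

/-- Multiplication by `x_i` on `F[x_1, …, x_n] e^{a·x}`, written on the coefficient `f` of
`f e^{a·x}`. -/
noncomputable def mulX (i : Fin n) : Module.End F (MvPolynomial (Fin n) F) :=
  LinearMap.mulLeft F (X i)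

/-- The partial derivative `∂/∂x_i` on `F[x_1, …, x_n] e^{a·x}`, written on the coefficient `f` of
`f e^{a·x}`: by the product rule `∂_i (f e^{a·x}) = (∂_i f + a_i f) e^{a·x}`. -/
noncomputable def partialX (a : Fin n → F) (i : Fin n) : Module.End F (MvPolynomial (Fin n) F) :=
  (pderiv i).toLinearMap + a i • LinearMap.id

/-- The operator that replaces `x_i`: it is `∂_i` if `i ∈ S` and `x_i` otherwise. -/
noncomputable def posOp (S : Finset (Fin n)) (a : Fin n → F) (i : Fin n) :
    Module.End F (MvPolynomial (Fin n) F) :=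
  if i ∈ S then partialX a i else mulX i

/-- The operator that replaces `∂_i`: it is `-x_i` if `i ∈ S` and `∂_i` otherwise. -/
noncomputable def momOp (S : Finset (Fin n)) (a : Fin n → F) (i : Fin n) :
    Module.End F (MvPolynomial (Fin n) F) :=
  if i ∈ S then -mulX i else partialX a i

/-- The operator that replaces `D = ∑ x_s ∂_s`. -/
noncomputable def eulerOp (S : Finset (Fin n)) (a : Fin n → F) :
    Module.End F (MvPolynomial (Fin n) F) :=
  ∑ s, posOp S a s * momOp S a s

/-- Left factors of the operators attached to the matrix units, see `matOp`. -/
noncomputable def leftOp (S : Finset (Fin n)) (a : Fin n → F) :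
    Fin (n + 1) → Module.End F (MvPolynomial (Fin n) F) :=
  Fin.snoc (posOp S a) (-1)

/-- Right factors of the operators attached to the matrix units, see `matOp`. -/
noncomputable def rightOp (c : F) (S : Finset (Fin n)) (a : Fin n → F) :
    Fin (n + 1) → Module.End F (MvPolynomial (Fin n) F) :=
  Fin.snoc (momOp S a) (eulerOp S a + c • 1)

/-- The operator attached to the matrix unit `E_{i,j}`. Writing `q_i = posOp S a i`,
`p_i = momOp S a i` and `D = eulerOp S a`, it is `q_i p_j` for `i, j ≤ n`, it is `q_i (D + c)` for
`E_{i,n+1}`, it is `-p_i` for `E_{n+1,i}`, and it is `-(D + c)` for `E_{n+1,n+1}`. (The last value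
matters only through differences such as `E_{n,n} - E_{n+1,n+1}`, sent to `q_n p_n + D + c`.) -/
noncomputable def matOp (c : F) (S : Finset (Fin n)) (a : Fin n → F) (i j : Fin (n + 1)) :
    Module.End F (MvPolynomial (Fin n) F) :=
  leftOp S a i * rightOp c S a j

/-- The linear extension of `matOp` to all square matrices of size `n + 1`. -/
noncomputable def matRep (c : F) (S : Finset (Fin n)) (a : Fin n → F) :
    Matrix (Fin (n + 1)) (Fin (n + 1)) F →ₗ[F] Module.End F (MvPolynomial (Fin n) F) where
  toFun A := ∑ i, ∑ j, A i j • matOp c S a i j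
  map_add' A B := by simp [add_smul, Finset.sum_add_distrib]
  map_smul' r A := by simp [mul_smul, Finset.smul_sum]

theorem end_neg_mul (A B : Module.End F (MvPolynomial (Fin n) F)) : -A * B = -(A * B) := by
  rfl

theorem end_mul_neg (A B : Module.End F (MvPolynomial (Fin n) F)) : A * -B = -(A * B) := by
  apply LinearMap.ext
  intro f
  simp [Module.End.mul_apply]

theorem mulX_comm (i j : Fin n) : (mulX i * mulX j : Module.End F _) = mulX j * mulX i := by
  apply LinearMap.ext; intro f
  simp only [mulX, Module.End.mul_apply, LinearMap.mulLeft_apply]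
  ring

theorem partialX_apply (a : Fin n → F) (i : Fin n) (f : MvPolynomial (Fin n) F) :
    partialX a i f = pderiv i f + C (a i) * f := by
  simp [partialX, smul_eq_C_mul]

theorem pderiv_comm' (i j : Fin n) (f : MvPolynomial (Fin n) F) :
    pderiv i (pderiv j f) = pderiv j (pderiv i f) := by
  have h : ⁅(pderiv i : Derivation F (MvPolynomial (Fin n) F) (MvPolynomial (Fin n) F)),
      (pderiv j : Derivation F (MvPolynomial (Fin n) F) (MvPolynomial (Fin n) F))⁆ = 0 := by
    apply MvPolynomial.derivation_ext
    intro k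
    rw [Derivation.commutator_apply, pderiv_X, pderiv_X]
    simp only [Pi.single_apply]
    split_ifs <;> simp
  have := congrArg (fun d : Derivation F (MvPolynomial (Fin n) F) (MvPolynomial (Fin n) F) => d f) h
  rw [Derivation.commutator_apply] at this
  simpa [sub_eq_zero] using this

theorem partialX_comm (a : Fin n → F) (i j : Fin n) :
    partialX a i * partialX a j = partialX a j * partialX a i := by
  apply LinearMap.ext; intro f
  simp only [Module.End.mul_apply, partialX_apply, map_add, pderiv_mul, pderiv_C, pderiv_comm' i j]
  ring

theorem partialX_mulX (a : Fin n → F) (i j : Fin n) :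
    partialX a i * mulX j = mulX j * partialX a i + if i = j then 1 else 0 := by
  apply LinearMap.ext; intro f
  simp only [mulX, Module.End.mul_apply, partialX_apply, LinearMap.mulLeft_apply, LinearMap.add_apply,
    pderiv_mul, pderiv_X, Pi.single_apply]
  split_ifs with h h' h'
  · simp only [Module.End.one_apply]; ring
  · exact absurd h.symm h'
  · exact absurd h'.symm h
  · simp only [LinearMap.zero_apply]; ring

theorem posOp_comm (S : Finset (Fin n)) (a : Fin n → F) (i j : Fin n) :
    posOp S a i * posOp S a j = posOp S a j * posOp S a i := by
  unfold posOp
  split_ifs with hi hj hj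
  · exact partialX_comm a i j
  · have hne : i ≠ j := fun h => hj (h ▸ hi)
    simp [partialX_mulX, hne]
  · have hne : j ≠ i := fun h => hi (h ▸ hj)
    simp [partialX_mulX, hne]
  · exact mulX_comm i j

theorem momOp_comm (S : Finset (Fin n)) (a : Fin n → F) (i j : Fin n) :
    momOp S a i * momOp S a j = momOp S a j * momOp S a i := by
  unfold momOp
  split_ifs with hi hj hj
  · simp only [end_neg_mul, end_mul_neg, mulX_comm i j]
  · have hne : j ≠ i := fun h => hj (h ▸ hi)
    simp only [end_neg_mul, end_mul_neg, partialX_mulX, hne, if_false, add_zero]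
  · have hne : i ≠ j := fun h => hi (h ▸ hj)
    simp only [end_neg_mul, end_mul_neg, partialX_mulX, hne, if_false, add_zero]
  · exact partialX_comm a i j

theorem momOp_posOp (S : Finset (Fin n)) (a : Fin n → F) (i j : Fin n) :
    momOp S a i * posOp S a j = posOp S a j * momOp S a i + if i = j then 1 else 0 := by
  unfold momOp posOp
  by_cases hi : i ∈ S <;> by_cases hj : j ∈ S
  · simp only [hi, hj, if_true, partialX_mulX, end_neg_mul, end_mul_neg, eq_comm (a := j)]
    abel
  · have hne : i ≠ j := fun h => hj (h ▸ hi)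
    simp only [hi, hj, hne, if_true, if_false, end_neg_mul, end_mul_neg, mulX_comm i j, add_zero]
  · have hne : i ≠ j := fun h => hi (h ▸ hj)
    simp [hi, hj, partialX_comm a i j, hne]
  · simp only [hi, hj, if_false, partialX_mulX]

theorem eulerOp_posOp (S : Finset (Fin n)) (a : Fin n → F) (j : Fin n) :
    eulerOp S a * posOp S a j = posOp S a j * eulerOp S a + posOp S a j := by
  have h : ∀ s, posOp S a s * momOp S a s * posOp S a j =
      posOp S a j * (posOp S a s * momOp S a s) + if s = j then posOp S a j else 0 := by
    intro s
    rw [mul_assoc, momOp_posOp, mul_add, ← mul_assoc, posOp_comm S a s j, mul_assoc]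
    split_ifs with h
    · rw [mul_one, h]
    · rw [mul_zero]
  simp [eulerOp, Finset.sum_mul, Finset.mul_sum, h, Finset.sum_add_distrib]

theorem momOp_eulerOp (S : Finset (Fin n)) (a : Fin n → F) (j : Fin n) :
    momOp S a j * eulerOp S a = eulerOp S a * momOp S a j + momOp S a j := by
  have h : ∀ s, momOp S a j * (posOp S a s * momOp S a s) =
      posOp S a s * momOp S a s * momOp S a j + if j = s then momOp S a j else 0 := by
    intro s
    rw [← mul_assoc, momOp_posOp, add_mul, mul_assoc, momOp_comm S a j s, mul_assoc]
    split_ifs with h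
    · rw [one_mul, h]
    · rw [zero_mul]
  simp [eulerOp, Finset.sum_mul, Finset.mul_sum, h, Finset.sum_add_distrib]

theorem leftOp_comm (S : Finset (Fin n)) (a : Fin n → F) (i j : Fin (n + 1)) :
    leftOp S a i * leftOp S a j = leftOp S a j * leftOp S a i := by
  unfold leftOp
  refine Fin.lastCases ?_ (fun i => ?_) i <;> refine Fin.lastCases ?_ (fun j => ?_) j <;>
    simp only [Fin.snoc_last, Fin.snoc_castSucc, end_neg_mul, end_mul_neg, one_mul, mul_one]
  exact posOp_comm S a _ _

theorem rightOp_leftOp (c : F) (S : Finset (Fin n)) (a : Fin n → F) (i j : Fin (n + 1)) :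
    rightOp c S a i * leftOp S a j = leftOp S a j * rightOp c S a i + (if i = j then 1 else 0)
      + if i = Fin.last n then leftOp S a j else 0 := by
  unfold leftOp rightOp
  refine Fin.lastCases ?_ (fun i => ?_) i <;> refine Fin.lastCases ?_ (fun j => ?_) j
  · simp only [Fin.snoc_last, if_true, end_neg_mul, end_mul_neg, one_mul, mul_one]
    abel
  · simp only [Fin.snoc_last, Fin.snoc_castSucc, if_true, add_mul, mul_add, eulerOp_posOp,
      (Fin.castSucc_lt_last j).ne', if_false, smul_mul_assoc, mul_smul_comm, one_mul, mul_one]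
    abel
  · simp only [Fin.snoc_last, Fin.snoc_castSucc, (Fin.castSucc_lt_last i).ne, if_false,
      end_neg_mul, end_mul_neg, one_mul, mul_one, add_zero]
  · simp [(Fin.castSucc_lt_last i).ne, momOp_posOp]

theorem rightOp_rightOp (c : F) (S : Finset (Fin n)) (a : Fin n → F) (i j : Fin (n + 1)) :
    rightOp c S a i * rightOp c S a j + (if i = Fin.last n then rightOp c S a j else 0) =
      rightOp c S a j * rightOp c S a i + if j = Fin.last n then rightOp c S a i else 0 := by
  unfold rightOp
  refine Fin.lastCases ?_ (fun i => ?_) i <;> refine Fin.lastCases ?_ (fun j => ?_) j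
  · rfl
  · simp only [Fin.snoc_last, Fin.snoc_castSucc, if_true, add_mul, mul_add, momOp_eulerOp,
      (Fin.castSucc_lt_last j).ne, if_false, smul_mul_assoc, mul_smul_comm, one_mul, mul_one]
    abel
  · simp only [Fin.snoc_last, Fin.snoc_castSucc, if_true, add_mul, mul_add, momOp_eulerOp,
      (Fin.castSucc_lt_last i).ne, if_false, smul_mul_assoc, mul_smul_comm, one_mul, mul_one]
    abel
  · simp [(Fin.castSucc_lt_last i).ne, (Fin.castSucc_lt_last j).ne, momOp_comm S a i j]

theorem matOp_lie (c : F) (S : Finset (Fin n)) (a : Fin n → F) (i j k l : Fin (n + 1)) :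
    matOp c S a i j * matOp c S a k l - matOp c S a k l * matOp c S a i j =
      (if j = k then matOp c S a i l else 0) - if l = i then matOp c S a k j else 0 := by
  have key : ∀ i j k l : Fin (n + 1), matOp c S a i j * matOp c S a k l =
      leftOp S a i * leftOp S a k * (rightOp c S a j * rightOp c S a l +
        if j = Fin.last n then rightOp c S a l else 0) +
      if j = k then matOp c S a i l else 0 := by
    intro i j k l
    unfold matOp
    rw [mul_assoc, ← mul_assoc (rightOp c S a j), rightOp_leftOp]
    split_ifs <;> simp only [mul_add, add_mul, mul_assoc, one_mul, add_zero]
    all_goals abel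
  rw [key, key k l i j, rightOp_rightOp, leftOp_comm S a k i]
  abel

theorem matRep_lie (c : F) (S : Finset (Fin n)) (a : Fin n → F)
    (A B : Matrix (Fin (n + 1)) (Fin (n + 1)) F) :
    matRep c S a ⁅A, B⁆ = ⁅matRep c S a A, matRep c S a B⁆ := by
  have hs : ∀ i j : Fin (n + 1), ∀ r : F,
      matRep c S a (Matrix.single i j r) = r • matOp c S a i j := by
    intro i j r
    simp [matRep, Matrix.single_apply, ite_and, ite_smul]
  induction A using Matrix.induction_on' with
  | h_zero => simp
  | h_add A A' hA hA' => rw [add_lie, map_add, hA, hA', map_add, add_lie]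
  | h_std_basis i j r =>
    induction B using Matrix.induction_on' with
    | h_zero => simp
    | h_add B B' hB hB' => rw [lie_add, map_add, hB, hB', map_add, lie_add]
    | h_std_basis k l t =>
      rw [LieRing.of_associative_ring_bracket, LieRing.of_associative_ring_bracket, hs, hs,
        smul_mul_smul_comm, smul_mul_smul_comm, mul_comm t r]
      refine Eq.trans ?_ (smul_sub (r * t) _ _)
      rw [matOp_lie, map_sub]
      refine Eq.trans ?_ (smul_sub (r * t) _ _).symm
      congr 1
      · split_ifs with h
        · subst h
          rw [Matrix.single_mul_single_same, hs]
        · rw [Matrix.single_mul_single_of_ne _ _ _ _ h, map_zero, smul_zero]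
      · split_ifs with h
        · subst h
          rw [Matrix.single_mul_single_same, hs, mul_comm]
        · rw [Matrix.single_mul_single_of_ne _ _ _ _ h, map_zero, smul_zero]

/-- The projective oscillator representation of `sl(n+1, F)` with parameters `c` and `S` on
`F[x_1, …, x_n] e^{a·x}`. -/
noncomputable def projRep (c : F) (S : Finset (Fin n)) (a : Fin n → F) :
    LieAlgebra.SpecialLinear.sl (Fin (n + 1)) F →ₗ⁅F⁆
      Module.End F (MvPolynomial (Fin n) F) where
  toLinearMap := (matRep c S a).comp
    (LieAlgebra.SpecialLinear.sl (Fin (n + 1)) F).toSubmodule.subtype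
  map_lie' {A B} := matRep_lie c S a A.1 B.1

end SpecialLinear

section Symplectic

/-- `sp(2m+2, F)`: the matrices in `(m+1) × (m+1)` blocks `[[A, B], [C, -Aᵀ]]` with `B`, `C`
symmetric. -/
abbrev Sp (F : Type*) [Field F] (m : ℕ) : Type _ :=
  ↥(LieAlgebra.Symplectic.sp (Fin (m + 1)) F)

/-- The numbering of rows and columns: the first block is `1, …, m+1`, the second one is
`m+2, …, 2m+2` (here counted from `0`). -/
def blockEquiv (m : ℕ) : Fin (m + 1) ⊕ Fin (m + 1) ≃ Fin (2 * m + 1 + 1) :=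
  finSumFinEquiv.trans (finCongr (by omega))

variable {F : Type*} [Field F] {m : ℕ}

theorem trace_eq_zero_of_mem_sp {A : Matrix (Fin (m + 1) ⊕ Fin (m + 1)) (Fin (m + 1) ⊕ Fin (m + 1)) F}
    (hA : A ∈ LieAlgebra.Symplectic.sp (Fin (m + 1)) F) : A.trace = 0 := by
  have h : ∀ i : Fin (m + 1), A (Sum.inr i) (Sum.inr i) = -A (Sum.inl i) (Sum.inl i) := by
    intro i
    have h1 := congrFun (congrFun ((mem_skewAdjointMatricesSubmodule (J := Matrix.J (Fin (m + 1)) F)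
      (A₁ := A)).1 hA) (Sum.inl i)) (Sum.inr i)
    simp only [Matrix.J, Matrix.mul_apply, Fintype.sum_sum_type, Matrix.transpose_apply,
      Matrix.fromBlocks_apply₁₁, Matrix.fromBlocks_apply₁₂, Matrix.fromBlocks_apply₂₂,
      Matrix.zero_apply, Matrix.neg_apply, Matrix.one_apply] at h1
    simp at h1
    exact h1.symm
  simp [Matrix.trace, Matrix.diag, h]

variable (F m) in
/-- The inclusion of `sp(2m+2, F)` in `sl(2m+2, F)`. -/
def spToSl : Sp F m →ₗ⁅F⁆ LieAlgebra.SpecialLinear.sl (Fin (2 * m + 1 + 1)) F where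
  toFun A := ⟨Matrix.reindexLieEquiv (blockEquiv m) A.1, by
    have h := trace_eq_zero_of_mem_sp A.2
    change Matrix.trace (Matrix.reindex (blockEquiv m) (blockEquiv m) A.1) = 0
    rw [← h]
    simp only [Matrix.trace, Matrix.diag, Matrix.reindex_apply, Matrix.submatrix_apply]
    exact Equiv.sum_comp (blockEquiv m).symm (fun i => A.1 i i)⟩
  map_add' A B := by
    apply Subtype.ext
    exact map_add (Matrix.reindexLieEquiv (blockEquiv m)) A.1 B.1
  map_smul' r A := by
    apply Subtype.ext
    exact map_smul (Matrix.reindexLieEquiv (blockEquiv m)) r A.1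
  map_lie' {A B} := by
    apply Subtype.ext
    exact LieEquiv.map_lie (Matrix.reindexLieEquiv (blockEquiv m)) A.1 B.1

/-- The space `F[x_1, …, x_n] e^{a·x}`, `n = 2m+1`, whose element `f e^{a·x}` is represented by `f`,
with the action of `sp(2m+2, F)` that depends on `c`, `S` and `a`. -/
def OscModule (_c : F) (_S : Finset (Fin (2 * m + 1))) (_a : Fin (2 * m + 1) → F) : Type _ :=
  MvPolynomial (Fin (2 * m + 1)) F

variable (c : F) (S : Finset (Fin (2 * m + 1))) (a : Fin (2 * m + 1) → F)

noncomputable instance : AddCommGroup (OscModule c S a) :=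
  inferInstanceAs (AddCommGroup (MvPolynomial (Fin (2 * m + 1)) F))

noncomputable instance : Module F (OscModule c S a) :=
  inferInstanceAs (Module F (MvPolynomial (Fin (2 * m + 1)) F))

/-- The restriction to `sp(2m+2, F)` of the projective oscillator representation of
`sl(2m+2, F)`. -/
noncomputable def spRep : Sp F m →ₗ⁅F⁆ Module.End F (OscModule c S a) :=
  LieHom.comp (projRep c S a) (spToSl F m)

noncomputable instance : LieRingModule (Sp F m) (OscModule c S a) where
  bracket A f := spRep c S a A f
  add_lie A B f := by rw [map_add]; rfl
  lie_add A f g := by exact map_add _ _ _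
  leibniz_lie A B f := by
    rw [LieHom.map_lie, LieRing.of_associative_ring_bracket]
    simp [Module.End.mul_apply]

noncomputable instance : LieModule F (Sp F m) (OscModule c S a) where
  smul_lie r A f := by
    change spRep c S a (r • A) f = r • spRep c S a A f
    rw [map_smul]; rfl
  lie_smul r A f := by exact map_smul (spRep c S a A) r f

end Symplectic

section Weights

variable (F : Type*) [Field F] (m : ℕ)

/-- The Cartan subalgebra of diagonal matrices in `sp(2m+2, F)`. -/
def cartan : LieSubalgebra F (Sp F m) where
  carrier := {A | A.1.IsDiag}
  zero_mem' := by exact Matrix.isDiag_zero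
  add_mem' := by exact fun hA hB => Matrix.IsDiag.add hA hB
  smul_mem' := by exact fun r A hA => Matrix.IsDiag.smul r hA
  lie_mem' := by
    intro A B hA hB
    change (A.1 * B.1 - B.1 * A.1).IsDiag
    have h1 := Matrix.IsDiag.diagonal_diag hA
    have h2 := Matrix.IsDiag.diagonal_diag hB
    rw [← h1, ← h2, Matrix.diagonal_mul_diagonal, Matrix.diagonal_mul_diagonal]
    exact (Matrix.isDiag_diagonal _).sub (Matrix.isDiag_diagonal _)

variable {m}

/-- The weight `ε_i`, with `ε_i (E_{j,j} - E_{m+1+j,m+1+j}) = δ_{i,j}`. -/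
def eps (i : Fin (m + 1)) : Module.Dual F (cartan F m) where
  toFun h := h.1.1 (Sum.inl i) (Sum.inl i)
  map_add' _ _ := rfl
  map_smul' _ _ := rfl

/-- The standard basis `δ_1 = -ε_{m+1}`, `δ_2 = ε_m`, `δ_3 = ε_{m-1}`, …, `δ_{m+1} = ε_1` of the
weights (the index is counted from `0`) for which the simple roots are
`δ_1 - δ_2, …, δ_m - δ_{m+1}, 2 δ_{m+1}`. -/
def del (i : Fin (m + 1)) : Module.Dual F (cartan F m) :=
  if i = 0 then -eps F i.rev else eps F i.rev

/-- The fundamental weights `λ_{i+1} = δ_1 + ⋯ + δ_{i+1}` (the index is counted from `0`). -/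
def fundWeight (i : Fin (m + 1)) : Module.Dual F (cartan F m) :=
  ∑ j ∈ Finset.Iic i, del F j

variable {F}

/-- The positive roots `δ_i - δ_j` (`i < j`) and `δ_i + δ_j` (`i ≤ j`). -/
def IsPositiveRoot (α : Module.Dual F (cartan F m)) : Prop :=
  ∃ i j : Fin (m + 1), (i < j ∧ α = del F i - del F j) ∨ (i ≤ j ∧ α = del F i + del F j)

variable (M : Type*) [AddCommGroup M] [Module F M] [LieRingModule (Sp F m) M]
  [LieModule F (Sp F m) M]

variable (F m) in
/-- `M` is a highest-weight module with highest weight `μ`: it is generated by a nonzero vector of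
weight `μ` that is killed by the root spaces of all positive roots. -/
def IsHighestWeightModule (μ : Module.Dual F (cartan F m)) : Prop :=
  ∃ v : M, v ≠ 0 ∧ v ∈ LieModule.weightSpace M (μ : cartan F m → F) ∧
    (∀ α : Module.Dual F (cartan F m), IsPositiveRoot α →
      ∀ A ∈ LieModule.weightSpace (Sp F m) (α : cartan F m → F), ⁅A, v⁆ = 0) ∧
    LieSubmodule.lieSpan F (Sp F m) {v} = ⊤

variable (F m) in
/-- `M` is a weight module: it is the direct sum of its weight subspaces. -/
def IsWeightModule : Prop :=
  iSupIndep (fun μ : Module.Dual F (cartan F m) =>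
      (LieModule.weightSpace M (μ : cartan F m → F)).toSubmodule) ∧
    ⨆ μ : Module.Dual F (cartan F m),
      (LieModule.weightSpace M (μ : cartan F m → F)).toSubmodule = ⊤

end Weights

section Indices

variable {m : ℕ}

/-- The index `i` of `{1, …, 2m+1}`, for `i` in `{1, …, m+1}` (counted from `0`). -/
def xIdx (i : Fin (m + 1)) : Fin (2 * m + 1) := ⟨i.1, by omega⟩

/-- The index `m+1+i` of `{1, …, 2m+1}`, for `i` in `{1, …, m}` (counted from `0`). -/
def yIdx (i : Fin m) : Fin (2 * m + 1) := ⟨m + 1 + i.1, by omega⟩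

/-- `m+1 ∉ S`, and for every `i` in `{1, …, m}` at most one of `i` and `m+1+i` lies in `S`. -/
def Admissible (S : Finset (Fin (2 * m + 1))) : Prop :=
  xIdx (Fin.last m) ∉ S ∧ ∀ i : Fin m, ¬(xIdx i.castSucc ∈ S ∧ yIdx i ∈ S)

end Indices

end ProjOsc

namespace ProjOsc

/-! ### Derivatives and multiplications on polynomials -/

section Derivatives

variable {F : Type*} [Field F] {σ : Type*}

/-! Write `z` for `x_{m+1}`, `q_i`, `p_i` for the operators replacing `x_i`, `∂_i`, and `r'` for the
partner of an index `r ≠ m+1` under `i ↔ m+1+i`. Up to sign and a factor 2, the symplectic algebra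
acts through `∂_z`, `z∂_z + D + c`, `z(D + c)`, `q_r ∂_z ± p_{r'}`, `q_r (D + c) ± z p_{r'}` and
`q_r p_{t'} ± q_t p_{r'}`. Let `N ≠ 0` be invariant. As `∂_z` is locally nilpotent, `N ∩ ker ∂_z ≠
0`, and on it all `p_r` and `D + c` act. If all `q_r` map it into `N` as well, it is a nonzero
module over the Weyl algebra in the variables other than `z`, hence contains all polynomials in
them; the operators `q_r (D + c) ± z p_{r'}` then produce every power of `z`, so `N` is everything
(`IsInvariant.eq_top_of_posOp_mem`).

There are two ways to obtain the `q_r`. For `a ≠ 0` there is `t ∉ S` with `a_t ≠ 0`; then `p_t = ∂_t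
+ a_t` is onto on `N ∩ ker ∂_z`, and the quadratic operators yield `q_{t'}` and then every `q_r`.
For `a = 0`, if `D + c` has no zero eigenvalue on monomials, it is onto on `N ∩ ker ∂_z`, so `q_r`
can be read off from `q_r (D + c) ± z p_{r'}`.

For `S = ∅`, `a = 0`, `c = -ℓ`, the operator `D + c` vanishes exactly in degree `ℓ`, so polynomials
of degree at most `ℓ` form a submodule. Raising from `1` shows that every nonzero invariant subspace
contains it. An invariant subspace containing it strictly contains a form of degree `ℓ + 1`, hence
`x_r^(ℓ+1)`, hence all monomials of degree `ℓ + 1`, and then all higher ones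
(`IsInvariant.eq_top_of_lt_totalDegree`).

For `a = 0` monomials are weight vectors, and admissibility lets a weight bound their degree.
Highest-weight vectors are `1` and, in the quotient, the class of `x_m^(ℓ+1)`. A coweight positive
on all positive roots shows that positive root vectors are strictly triangular, so these vectors are
checked on matrix units. -/

theorem coeff_eq_zero_of_pderiv_eq_zero [CharZero F] {i : σ} {f : MvPolynomial σ F}
    (h : pderiv i f = 0) {s : σ →₀ ℕ} (hs : s i ≠ 0) : coeff s f = 0 := by
  classical
  have h1 := coeff_pderiv (i := i) f (s - Finsupp.single i 1)
  have h2 : s - Finsupp.single i 1 + Finsupp.single i 1 = s :=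
    tsub_add_cancel_of_le (by simpa [Nat.one_le_iff_ne_zero] using hs)
  rw [h, h2, coeff_zero] at h1
  have h3 : (((s - Finsupp.single i 1 : σ →₀ ℕ) i : F) + 1) ≠ 0 := Nat.cast_add_one_ne_zero _
  exact (mul_eq_zero.1 h1.symm).resolve_right h3

theorem eq_C_of_forall_pderiv_eq_zero [CharZero F] {f : MvPolynomial σ F}
    (h : ∀ i, pderiv i f = 0) : f = C (coeff 0 f) := by
  classical
  ext s
  rw [coeff_C]
  split_ifs with hs
  · rw [hs]
  · obtain ⟨i, hi⟩ := Finsupp.ne_iff.1 (Ne.symm hs)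
    exact coeff_eq_zero_of_pderiv_eq_zero (h i) hi

theorem degree_add_single (s : σ →₀ ℕ) (i : σ) :
    (s + Finsupp.single i 1).degree = s.degree + 1 := by
  simp [map_add]

theorem totalDegree_pderiv_lt {i : σ} {f : MvPolynomial σ F} (h : pderiv i f ≠ 0) :
    (pderiv i f).totalDegree < f.totalDegree := by
  classical
  obtain ⟨s, hs, hd⟩ := Finset.exists_mem_eq_sup (pderiv i f).support (by simpa using h)
    (fun s => s.degree)
  have h1 : (pderiv i f).totalDegree = s.degree := hd
  rw [mem_support_iff, coeff_pderiv] at hs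
  have h2 := le_totalDegree (mem_support_iff.2 (left_ne_zero_of_mul hs))
  have h3 := degree_add_single s i
  rw [h1]
  change (s + Finsupp.single i 1).degree ≤ _ at h2
  omega

/-- A nonzero space of polynomials that is stable under some of the partial derivatives contains a
nonzero polynomial killed by all of these derivatives. -/
theorem exists_mem_forall_pderiv_eq_zero (T : Set σ) {N : Submodule F (MvPolynomial σ F)}
    (hN : ∀ i ∈ T, ∀ f ∈ N, pderiv i f ∈ N) {f : MvPolynomial σ F} (hf : f ∈ N) (h0 : f ≠ 0) :
    ∃ g ∈ N, g ≠ 0 ∧ ∀ i ∈ T, pderiv i g = 0 := by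
  induction hd : f.totalDegree using Nat.strong_induction_on generalizing f with
  | _ d ih =>
    by_cases h : ∀ i ∈ T, pderiv i f = 0
    · exact ⟨f, hf, h0, h⟩
    · push Not at h
      obtain ⟨i, hi, hne⟩ := h
      exact ih _ (hd ▸ totalDegree_pderiv_lt hne) (hN i hi f hf) hne rfl

/-- Partial derivatives lower the degree, so differentiating as long as possible ends at a nonzero
constant; characteristic 0 makes constants the only common kernel. -/
theorem one_mem_of_forall_pderiv_mem [CharZero F] {N : Submodule F (MvPolynomial σ F)}
    (hN : ∀ i, ∀ f ∈ N, pderiv i f ∈ N) (h : N ≠ ⊥) : (1 : MvPolynomial σ F) ∈ N := by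
  obtain ⟨f, hf, h0⟩ := Submodule.exists_mem_ne_zero_of_ne_bot h
  obtain ⟨g, hg, hg0, hz⟩ := exists_mem_forall_pderiv_eq_zero Set.univ (fun i _ => hN i) hf h0
  have h1 := eq_C_of_forall_pderiv_eq_zero fun i => hz i trivial
  have hc : coeff 0 g ≠ 0 := fun hc => hg0 (by rw [h1, hc, C_0])
  have := N.smul_mem (coeff 0 g)⁻¹ hg
  rwa [h1, smul_eq_C_mul, coeff_zero_C, ← C_mul, inv_mul_cancel₀ hc, C_1] at this

/-- The space of polynomials that do not involve the variable `z`. -/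
noncomputable def freeOf (F : Type*) [Field F] {σ : Type*} (z : σ) :
    Submodule F (MvPolynomial σ F) :=
  LinearMap.ker (pderiv z).toLinearMap

theorem mem_freeOf {z : σ} {f : MvPolynomial σ F} : f ∈ freeOf F z ↔ pderiv z f = 0 := Iff.rfl

theorem monomial_mem_freeOf {z : σ} {s : σ →₀ ℕ} (hs : s z = 0) (c : F) :
    monomial s c ∈ freeOf F z := by
  simp [mem_freeOf, pderiv_monomial, hs]

theorem freeOf_le [CharZero F] {z : σ} {N : Submodule F (MvPolynomial σ F)}
    (h : ∀ s : σ →₀ ℕ, s z = 0 → monomial s 1 ∈ N) : freeOf F z ≤ N := by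
  intro f hf
  rw [f.as_sum]
  refine Submodule.sum_mem _ fun s hs => ?_
  have hz : s z = 0 := by
    by_contra hne
    exact mem_support_iff.1 hs (coeff_eq_zero_of_pderiv_eq_zero hf hne)
  have := N.smul_mem (coeff s f) (h s hz)
  rwa [smul_monomial, smul_eq_mul, mul_one] at this

theorem X_mul_monomial (i : σ) (s : σ →₀ ℕ) (c : F) :
    X i * monomial s c = monomial (s + Finsupp.single i 1) c := by
  rw [monomial_add_single, pow_one, mul_comm]

theorem X_mul_mem_freeOf {z i : σ} (hi : i ≠ z) {f : MvPolynomial σ F} (hf : f ∈ freeOf F z) :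
    X i * f ∈ freeOf F z := by
  classical
  rw [mem_freeOf] at hf ⊢
  simp [hf, pderiv_X_of_ne hi]

theorem pderiv_comm (i j : σ) (f : MvPolynomial σ F) :
    pderiv i (pderiv j f) = pderiv j (pderiv i f) := by
  classical
  ext s
  simp only [coeff_pderiv, add_right_comm s, Finsupp.add_apply, Finsupp.single_apply]
  split_ifs with h h' h' <;> simp_all [mul_right_comm]

theorem pderiv_mem_freeOf {z : σ} (i : σ) {f : MvPolynomial σ F} (hf : f ∈ freeOf F z) :
    pderiv i f ∈ freeOf F z := by
  rw [mem_freeOf] at hf ⊢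
  rw [pderiv_comm, hf, map_zero]

/-- The polynomials in the variables other than `z` form a simple module over their Weyl algebra. -/
theorem freeOf_le_of_stable [CharZero F] {z : σ} {K : Submodule F (MvPolynomial σ F)} (h : K ≠ ⊥)
    (hz : K ≤ freeOf F z) (hd : ∀ i ≠ z, ∀ f ∈ K, pderiv i f ∈ K)
    (hx : ∀ i ≠ z, ∀ f ∈ K, X i * f ∈ K) : freeOf F z ≤ K := by
  classical
  have h1 : (1 : MvPolynomial σ F) ∈ K := by
    refine one_mem_of_forall_pderiv_mem (fun i f hf => ?_) h
    rcases eq_or_ne i z with rfl | hi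
    · rw [mem_freeOf.1 (hz hf)]; exact K.zero_mem
    · exact hd i hi f hf
  refine freeOf_le fun s hs => ?_
  induction hk : s.degree generalizing s with
  | zero =>
    rw [Finsupp.degree_eq_zero_iff] at hk
    subst hk
    exact h1
  | succ k ih =>
    obtain ⟨i, hi⟩ : ∃ i, s i ≠ 0 := by
      by_contra! hall
      rw [show s = 0 from Finsupp.ext hall] at hk
      simp at hk
    have hiz : i ≠ z := fun e => hi (e ▸ hs)
    have h2 : s - Finsupp.single i 1 + Finsupp.single i 1 = s :=
      tsub_add_cancel_of_le (by simpa [Nat.one_le_iff_ne_zero] using hi)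
    have h3 := hx i hiz _ (ih (s - Finsupp.single i 1) (by simp [hs])
      (by have := degree_add_single (s - Finsupp.single i 1) i; rw [h2] at this; omega))
    rwa [X_mul_monomial, h2] at h3

/-- On a space of polynomials stable under `∂_i`, the operator `∂_i + a` with `a ≠ 0` is onto. -/
theorem exists_pderiv_add_eq {i : σ} {a : F} (ha : a ≠ 0) {K : Submodule F (MvPolynomial σ F)}
    (hK : ∀ f ∈ K, pderiv i f ∈ K) {f : MvPolynomial σ F} (hf : f ∈ K) :
    ∃ g ∈ K, pderiv i g + C a * g = f := by
  induction hd : f.totalDegree using Nat.strong_induction_on generalizing f with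
  | _ d ih =>
    by_cases h : pderiv i f = 0
    · refine ⟨a⁻¹ • f, K.smul_mem _ hf, ?_⟩
      rw [Derivation.map_smul, h, smul_zero, zero_add, ← smul_eq_C_mul, smul_inv_smul₀ ha]
    -- If `(∂_i + a) g = ∂_i f`, then `a⁻¹ (f - g)` is a preimage of `f`: this is the Neumann series
    -- for the locally nilpotent `∂_i`.
    · obtain ⟨g, hg, e⟩ := ih _ (hd ▸ totalDegree_pderiv_lt h) (hK f hf) rfl
      refine ⟨a⁻¹ • (f - g), K.smul_mem _ (K.sub_mem hf hg), ?_⟩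
      rw [← smul_eq_C_mul, smul_inv_smul₀ ha, Derivation.map_smul, map_sub, ← e, add_sub_cancel_left,
        ← smul_eq_C_mul, inv_smul_smul₀ ha]
      abel

theorem exists_pderiv_eq [CharZero F] {z i : σ} (hi : i ≠ z) {f : MvPolynomial σ F}
    (hf : f ∈ freeOf F z) : ∃ g ∈ freeOf F z, pderiv i g = f := by
  classical
  suffices h : freeOf F z ≤ (freeOf F z).map (pderiv i).toLinearMap from h hf
  refine freeOf_le fun s hs => ⟨monomial (s + Finsupp.single i 1) ((s i + 1 : F)⁻¹),
    monomial_mem_freeOf (by simp [hs, hi]) _, ?_⟩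
  have : (s i + 1 : F) ≠ 0 := Nat.cast_add_one_ne_zero _
  simp [pderiv_monomial, this]

end Derivatives

/-! ### Generators of the symplectic algebra and their operators -/

section Generators

variable {F : Type*} [Field F] {m : ℕ}

/-- The last of the indices `1, …, m+1`, which is paired with the index `2m+2`. -/
def zIdx : Fin (2 * m + 1) := xIdx (Fin.last m)

/-- The indices other than `zIdx`: those of the `x_i` on the left, those of the `x_{m+1+i}` on the
right. -/
def idx : Fin m ⊕ Fin m → Fin (2 * m + 1) := Sum.elim (fun i => xIdx i.castSucc) yIdx

theorem idx_injective : Function.Injective (idx (m := m)) := by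
  rintro (i | i) (j | j) h <;> simp only [idx, xIdx, yIdx, Sum.elim_inl, Sum.elim_inr,
    Fin.mk.injEq, Fin.val_castSucc] at h
  · rw [Fin.ext h]
  · omega
  · omega
  · rw [Fin.ext (by omega : i.1 = j.1)]

theorem idx_ne_zIdx (r : Fin m ⊕ Fin m) : idx r ≠ zIdx := by
  rcases r with i | i <;> simp only [idx, zIdx, xIdx, yIdx, Sum.elim_inl, Sum.elim_inr, ne_eq,
    Fin.mk.injEq, Fin.val_castSucc, Fin.val_last] <;> omega

theorem eq_zIdx_or_exists_idx (i : Fin (2 * m + 1)) : i = zIdx ∨ ∃ r, i = idx r := by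
  rcases lt_trichotomy i.1 m with h | h | h
  · exact Or.inr ⟨Sum.inl ⟨i.1, h⟩, rfl⟩
  · exact Or.inl (Fin.ext h)
  · refine Or.inr ⟨Sum.inr ⟨i.1 - (m + 1), by omega⟩, Fin.ext ?_⟩
    simp only [idx, yIdx, Sum.elim_inr]
    omega

theorem exists_idx_of_ne {i : Fin (2 * m + 1)} (h : i ≠ zIdx) : ∃ r, i = idx r :=
  (eq_zIdx_or_exists_idx i).resolve_left h

variable (F) in
/-- The sign attached to the two halves of a symplectic basis. -/
def sgn {α : Type*} : α ⊕ α → F := Sum.elim (fun _ => 1) (fun _ => -1)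

theorem sgn_inl {α : Type*} (i : α) : sgn F (Sum.inl i : α ⊕ α) = 1 := rfl

theorem sgn_inr {α : Type*} (i : α) : sgn F (Sum.inr i : α ⊕ α) = -1 := rfl

theorem sgn_swap {α : Type*} (r : α ⊕ α) : sgn F r.swap = -sgn F r := by
  rcases r with r | r <;> simp [sgn]

theorem sgn_ne_zero {α : Type*} (r : α ⊕ α) : sgn F r ≠ 0 := by
  rcases r with r | r <;> simp [sgn]

theorem matRep_single {n : ℕ} (c : F) (S : Finset (Fin n)) (a : Fin n → F) (i j : Fin (n + 1))
    (r : F) : matRep c S a (Matrix.single i j r) = r • matOp c S a i j := by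
  simp [matRep, Matrix.single_apply, ite_and, ite_smul]

variable (F) in
/-- The element `± E_{i,j'} ± E_{j,i'}` of the symplectic Lie algebra. -/
def spGen (i j : Fin (m + 1) ⊕ Fin (m + 1)) : Sp F m :=
  ⟨Matrix.single i j.swap (sgn F j) + Matrix.single j i.swap (sgn F i), by
    -- The matrix is `-(E_{i,j} + E_{j,i}) J`, and a symmetric matrix times `J` is in the symplectic
    -- algebra.
    have hJ : ∀ k l : Fin (m + 1) ⊕ Fin (m + 1),
        Matrix.single k l.swap (sgn F l) = -(Matrix.single k l 1 * Matrix.J (Fin (m + 1)) F) := by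
      intro k l
      ext p q
      rcases l with l | l <;> rcases q with q | q <;>
        simp [Matrix.mul_apply, Matrix.single_apply, Matrix.J, sgn, ite_and, Matrix.one_apply,
          eq_comm]
      all_goals split_ifs <;> simp
    have hJT := Matrix.J_transpose (Fin (m + 1)) F
    rw [hJ i j, hJ j i, ← neg_add, ← add_mul]
    refine (mem_skewAdjointMatricesSubmodule _ _).2 ?_
    change Matrix.transpose (-(_ * _)) * _ = _ * - -(_ * _)
    rw [Matrix.transpose_neg, Matrix.transpose_mul, hJT, Matrix.transpose_add,
      Matrix.transpose_single, Matrix.transpose_single, neg_neg, neg_mul, neg_mul, neg_mul, neg_neg,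
      add_comm (Matrix.single j i 1), Matrix.mul_assoc]⟩

/-- A space of polynomials that is stable under the action of the symplectic Lie algebra. -/
def IsInvariant (c : F) (S : Finset (Fin (2 * m + 1))) (a : Fin (2 * m + 1) → F)
    (N : Submodule F (MvPolynomial (Fin (2 * m + 1)) F)) : Prop :=
  ∀ A : Sp F m, ∀ f ∈ N, matRep c S a (Matrix.reindex (blockEquiv m) (blockEquiv m) A.1) f ∈ N

variable {c : F} {S : Finset (Fin (2 * m + 1))} {a : Fin (2 * m + 1) → F}
  {N : Submodule F (MvPolynomial (Fin (2 * m + 1)) F)}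

theorem IsInvariant.matOp_mem (h : IsInvariant c S a N) (i j : Fin (m + 1) ⊕ Fin (m + 1))
    {f : MvPolynomial (Fin (2 * m + 1)) F} (hf : f ∈ N) :
    sgn F j • matOp c S a (blockEquiv m i) (blockEquiv m j.swap) f +
      sgn F i • matOp c S a (blockEquiv m j) (blockEquiv m i.swap) f ∈ N := by
  have h1 := h (spGen F i j) f hf
  have h2 : Matrix.reindex (blockEquiv m) (blockEquiv m) (spGen F i j).1 =
      Matrix.single (blockEquiv m i) (blockEquiv m j.swap) (sgn F j) +
        Matrix.single (blockEquiv m j) (blockEquiv m i.swap) (sgn F i) := by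
    ext p q
    simp [spGen, Matrix.single_apply, Equiv.eq_symm_apply]
  rwa [h2, map_add, matRep_single, matRep_single] at h1

theorem blockEquiv_map (r : Fin m ⊕ Fin m) :
    blockEquiv m (r.map Fin.castSucc Fin.castSucc) = (idx r).castSucc := by
  rcases r with i | i <;> apply Fin.ext <;> simp [blockEquiv, idx, xIdx, yIdx, add_comm]

theorem blockEquiv_inl_last :
    blockEquiv m (Sum.inl (Fin.last m)) = (zIdx : Fin (2 * m + 1)).castSucc := by
  apply Fin.ext; simp [blockEquiv, zIdx, xIdx]

theorem blockEquiv_inr_last :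
    blockEquiv m (Sum.inr (Fin.last m)) = Fin.last (2 * m + 1) := by
  apply Fin.ext; simp [blockEquiv]; omega

theorem swap_map (r : Fin m ⊕ Fin m) : (r.map Fin.castSucc Fin.castSucc).swap =
    (r.swap).map Fin.castSucc Fin.castSucc := by
  rcases r with i | i <;> rfl

theorem sgn_map (r : Fin m ⊕ Fin m) : sgn F (r.map Fin.castSucc Fin.castSucc) = sgn F r := by
  rcases r with i | i <;> rfl

/-- The operator `D + c`. -/
noncomputable def shiftedEuler (c : F) (S : Finset (Fin (2 * m + 1))) (a : Fin (2 * m + 1) → F) :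
    Module.End F (MvPolynomial (Fin (2 * m + 1)) F) :=
  eulerOp S a + c • 1

theorem posOp_zIdx (hz : zIdx ∉ S) (f : MvPolynomial (Fin (2 * m + 1)) F) :
    posOp S a zIdx f = X zIdx * f := by
  simp [posOp, hz, mulX]

theorem momOp_zIdx (hz : zIdx ∉ S) (ha : a zIdx = 0) (f : MvPolynomial (Fin (2 * m + 1)) F) :
    momOp S a zIdx f = pderiv zIdx f := by
  simp [momOp, hz, partialX_apply, ha]

/-- These elements belong to the copy of `sp(2m)` acting on the variables other than `z`. -/
theorem IsInvariant.quadratic_mem (h : IsInvariant c S a N) (r t : Fin m ⊕ Fin m)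
    {f : MvPolynomial (Fin (2 * m + 1)) F} (hf : f ∈ N) :
    sgn F t • posOp S a (idx r) (momOp S a (idx t.swap) f) +
      sgn F r • posOp S a (idx t) (momOp S a (idx r.swap) f) ∈ N := by
  have := h.matOp_mem (r.map Fin.castSucc Fin.castSucc) (t.map Fin.castSucc Fin.castSucc) hf
  simpa only [swap_map, sgn_map, blockEquiv_map, matOp, leftOp, rightOp, Fin.snoc_castSucc,
    Module.End.mul_apply] using this

theorem IsInvariant.pderiv_mem [CharZero F] (hz : zIdx ∉ S) (ha : a zIdx = 0)
    (h : IsInvariant c S a N)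
    {f : MvPolynomial (Fin (2 * m + 1)) F} (hf : f ∈ N) : pderiv zIdx f ∈ N := by
  have := h.matOp_mem (Sum.inr (Fin.last m)) (Sum.inr (Fin.last m)) hf
  simp only [Sum.swap_inr, blockEquiv_inl_last, blockEquiv_inr_last, matOp, leftOp, rightOp,
    Fin.snoc_castSucc, Fin.snoc_last, Module.End.mul_apply, momOp_zIdx hz ha, sgn_inr,
    LinearMap.neg_apply, Module.End.one_apply, neg_smul, one_smul, neg_neg] at this
  have h2 := N.smul_mem (2 : F)⁻¹ this
  rwa [← two_smul F, inv_smul_smul₀ two_ne_zero] at h2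

theorem IsInvariant.euler_mem (hz : zIdx ∉ S) (ha : a zIdx = 0)
    (h : IsInvariant c S a N)
    {f : MvPolynomial (Fin (2 * m + 1)) F} (hf : f ∈ N) :
    X zIdx * pderiv zIdx f + shiftedEuler c S a f ∈ N := by
  have := h.matOp_mem (Sum.inl (Fin.last m)) (Sum.inr (Fin.last m)) hf
  simp only [Sum.swap_inr, Sum.swap_inl, blockEquiv_inl_last, blockEquiv_inr_last, matOp, leftOp,
    rightOp, Fin.snoc_castSucc, Fin.snoc_last, Module.End.mul_apply, momOp_zIdx hz ha,
    posOp_zIdx hz, sgn_inr, sgn_inl,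
    LinearMap.neg_apply, Module.End.one_apply, neg_smul, one_smul] at this
  rw [← N.neg_mem_iff, neg_add]
  exact this

theorem IsInvariant.X_mul_euler_mem [CharZero F] (hz : zIdx ∉ S) (h : IsInvariant c S a N)
    {f : MvPolynomial (Fin (2 * m + 1)) F} (hf : f ∈ N) :
    X zIdx * shiftedEuler c S a f ∈ N := by
  have := h.matOp_mem (Sum.inl (Fin.last m)) (Sum.inl (Fin.last m)) hf
  simp only [Sum.swap_inl, blockEquiv_inl_last, blockEquiv_inr_last, matOp, leftOp,
    rightOp, Fin.snoc_castSucc, Fin.snoc_last, Module.End.mul_apply,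
    posOp_zIdx hz, sgn_inl, one_smul] at this
  have h2 := N.smul_mem (2 : F)⁻¹ this
  rwa [← two_smul F, inv_smul_smul₀ two_ne_zero] at h2

/-- On `ker ∂_z` the first summand disappears and a multiple of `p_{r'}` remains. -/
theorem IsInvariant.lower_mem (hz : zIdx ∉ S) (ha : a zIdx = 0)
    (h : IsInvariant c S a N) (r : Fin m ⊕ Fin m)
    {f : MvPolynomial (Fin (2 * m + 1)) F} (hf : f ∈ N) :
    posOp S a (idx r) (pderiv zIdx f) + sgn F r • momOp S a (idx r.swap) f ∈ N := by
  have := h.matOp_mem (r.map Fin.castSucc Fin.castSucc) (Sum.inr (Fin.last m)) hf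
  simp only [Sum.swap_inr, swap_map, sgn_map, blockEquiv_map, blockEquiv_inl_last,
    blockEquiv_inr_last, matOp, leftOp, rightOp, Fin.snoc_castSucc, Fin.snoc_last,
    Module.End.mul_apply, momOp_zIdx hz ha, sgn_inr,
    LinearMap.neg_apply, Module.End.one_apply, neg_smul, one_smul, smul_neg] at this
  rw [← N.neg_mem_iff, neg_add]
  exact this

/-- The source of both `q_r`, once `D + c` is inverted, and new powers of `z`, once `p_{r'}` is
inverted. -/
theorem IsInvariant.raise_mem (hz : zIdx ∉ S) (h : IsInvariant c S a N) (r : Fin m ⊕ Fin m)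
    {f : MvPolynomial (Fin (2 * m + 1)) F} (hf : f ∈ N) :
    posOp S a (idx r) (shiftedEuler c S a f) +
      sgn F r • (X zIdx * momOp S a (idx r.swap) f) ∈ N := by
  have := h.matOp_mem (r.map Fin.castSucc Fin.castSucc) (Sum.inl (Fin.last m)) hf
  simp only [Sum.swap_inl, swap_map, sgn_map, blockEquiv_map, blockEquiv_inl_last,
    blockEquiv_inr_last, matOp, leftOp, rightOp, Fin.snoc_castSucc, Fin.snoc_last,
    Module.End.mul_apply, posOp_zIdx hz, sgn_inl, one_smul] at this
  exact this

end Generators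

/-! ### Irreducibility criteria through the Weyl algebra -/

section Irreducibility

variable {F : Type*} [Field F] {m : ℕ} {c : F} {S : Finset (Fin (2 * m + 1))}
  {a : Fin (2 * m + 1) → F} {N : Submodule F (MvPolynomial (Fin (2 * m + 1)) F)}

theorem partialX_mem_freeOf {z : Fin (2 * m + 1)} (i : Fin (2 * m + 1))
    {f : MvPolynomial (Fin (2 * m + 1)) F} (hf : f ∈ freeOf F z) : partialX a i f ∈ freeOf F z := by
  rw [partialX_apply, ← smul_eq_C_mul]
  exact add_mem (pderiv_mem_freeOf i hf) (Submodule.smul_mem _ _ hf)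

theorem posOp_mem_freeOf {z i : Fin (2 * m + 1)} (hi : i ≠ z)
    {f : MvPolynomial (Fin (2 * m + 1)) F} (hf : f ∈ freeOf F z) : posOp S a i f ∈ freeOf F z := by
  unfold posOp
  split_ifs
  · exact partialX_mem_freeOf i hf
  · exact X_mul_mem_freeOf hi hf

theorem momOp_mem_freeOf {z i : Fin (2 * m + 1)} (hi : i ≠ z)
    {f : MvPolynomial (Fin (2 * m + 1)) F} (hf : f ∈ freeOf F z) : momOp S a i f ∈ freeOf F z := by
  unfold momOp
  split_ifs
  · exact neg_mem (X_mul_mem_freeOf hi hf)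
  · exact partialX_mem_freeOf i hf

theorem shiftedEuler_apply (f : MvPolynomial (Fin (2 * m + 1)) F) :
    shiftedEuler c S a f = eulerOp S a f + c • f := rfl

/-- The relation `[∂_z, D] = ∂_z` makes `D` preserve `ker ∂_z`. -/
theorem shiftedEuler_mem_freeOf (hz : zIdx ∉ S) (ha : a zIdx = 0)
    {f : MvPolynomial (Fin (2 * m + 1)) F} (hf : f ∈ freeOf F zIdx) :
    shiftedEuler c S a f ∈ freeOf F zIdx := by
  have h := LinearMap.congr_fun (momOp_eulerOp S a zIdx) f
  simp only [Module.End.mul_apply, LinearMap.add_apply, momOp_zIdx hz ha] at h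
  rw [mem_freeOf] at hf
  rw [shiftedEuler_apply]
  refine add_mem ?_ (Submodule.smul_mem _ _ hf)
  rw [mem_freeOf, h, hf, map_zero, add_zero]

theorem shiftedEuler_X_pow_mul (hz : zIdx ∉ S) (k : ℕ) (f : MvPolynomial (Fin (2 * m + 1)) F) :
    shiftedEuler c S a (X zIdx ^ k * f) = X zIdx ^ k * (shiftedEuler c S a f + (k : F) • f) := by
  induction k generalizing f with
  | zero => simp
  | succ k ih =>
    have h := LinearMap.congr_fun (eulerOp_posOp S a zIdx) f
    simp only [Module.End.mul_apply, LinearMap.add_apply, posOp_zIdx hz] at h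
    rw [pow_succ, mul_assoc, ih, shiftedEuler_apply, h, shiftedEuler_apply]
    push_cast
    simp only [add_smul, one_smul, smul_eq_C_mul]
    ring

theorem posOp_X_pow_mul (hz : zIdx ∉ S) (i : Fin (2 * m + 1)) (k : ℕ)
    (f : MvPolynomial (Fin (2 * m + 1)) F) :
    posOp S a i (X zIdx ^ k * f) = X zIdx ^ k * posOp S a i f := by
  induction k generalizing f with
  | zero => simp
  | succ k ih =>
    have h := LinearMap.congr_fun (posOp_comm S a i zIdx) f
    simp only [Module.End.mul_apply, posOp_zIdx hz] at h
    rw [pow_succ, mul_assoc, ih, h, mul_assoc]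

theorem momOp_X_pow_mul (hz : zIdx ∉ S) {i : Fin (2 * m + 1)} (hi : i ≠ zIdx) (k : ℕ)
    (f : MvPolynomial (Fin (2 * m + 1)) F) :
    momOp S a i (X zIdx ^ k * f) = X zIdx ^ k * momOp S a i f := by
  induction k generalizing f with
  | zero => simp
  | succ k ih =>
    have h := LinearMap.congr_fun (momOp_posOp S a i zIdx) f
    simp only [Module.End.mul_apply, posOp_zIdx hz, if_neg hi, add_zero] at h
    rw [pow_succ, mul_assoc, ih, h, mul_assoc]

theorem IsInvariant.momOp_mem (hz : zIdx ∉ S) (ha : a zIdx = 0) (h : IsInvariant c S a N)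
    (r : Fin m ⊕ Fin m) {f : MvPolynomial (Fin (2 * m + 1)) F} (hf : f ∈ N)
    (hf' : f ∈ freeOf F zIdx) : momOp S a (idx r) f ∈ N := by
  have h1 := h.lower_mem hz ha r.swap hf
  rw [mem_freeOf.1 hf', map_zero, zero_add, Sum.swap_swap] at h1
  exact (N.smul_mem_iff (sgn_ne_zero _)).1 h1

theorem IsInvariant.shiftedEuler_mem (hz : zIdx ∉ S) (ha : a zIdx = 0) (h : IsInvariant c S a N)
    {f : MvPolynomial (Fin (2 * m + 1)) F} (hf : f ∈ N) (hf' : f ∈ freeOf F zIdx) :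
    shiftedEuler c S a f ∈ N := by
  have h1 := h.euler_mem hz ha hf
  rwa [mem_freeOf.1 hf', mul_zero, zero_add] at h1

/-- For `i ∉ S` the operator is `∂_i + a_i`: antiderivatives serve if `a_i = 0`, local nilpotency of
`∂_i` if not. -/
theorem exists_momOp_eq [CharZero F] {i : Fin (2 * m + 1)} (hi : i ≠ zIdx) (hS : i ∉ S)
    {f : MvPolynomial (Fin (2 * m + 1)) F} (hf : f ∈ freeOf F zIdx) :
    ∃ g ∈ freeOf F zIdx, momOp S a i g = f := by
  simp only [momOp, hS, if_false, partialX_apply]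
  by_cases h : a i = 0
  · simpa [h] using exists_pderiv_eq hi hf
  · exact exists_pderiv_add_eq h (fun _ => pderiv_mem_freeOf i) hf

/-- For every `i`, one of the variables `x_i`, `x_{m+1+i}` is not in `S`. -/
theorem Admissible.exists_notMem (hS : Admissible S) (hm : 1 ≤ m) :
    ∃ r : Fin m ⊕ Fin m, idx r ∉ S := by
  by_contra! h
  exact hS.2 ⟨0, hm⟩ ⟨h (Sum.inl _), h (Sum.inr _)⟩

theorem eq_top_of_X_pow_mul_mem {z : Fin (2 * m + 1)}
    (h : ∀ k : ℕ, ∀ f ∈ freeOf F z, X z ^ k * f ∈ N) : N = ⊤ := by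
  refine Submodule.eq_top_iff'.2 fun f => ?_
  rw [f.as_sum]
  refine Submodule.sum_mem _ fun s _ => ?_
  have := h (s z) (monomial (s.erase z) (coeff s f)) (monomial_mem_freeOf (by simp) _)
  rwa [X_pow_eq_monomial, monomial_mul, one_mul, Finsupp.single_add_erase] at this

/-- The last nonzero iterated `z`-derivative of an element of `N` lies in the intersection. -/
theorem IsInvariant.inf_freeOf_ne_bot [CharZero F] (hz : zIdx ∉ S) (ha : a zIdx = 0)
    (h : IsInvariant c S a N) (h0 : N ≠ ⊥) : N ⊓ freeOf F zIdx ≠ ⊥ := by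
  obtain ⟨f, hf, hf0⟩ := Submodule.exists_mem_ne_zero_of_ne_bot h0
  obtain ⟨g, hg, hg0, hgz⟩ := exists_mem_forall_pderiv_eq_zero {zIdx}
    (N := N) (by rintro _ rfl f hf; exact h.pderiv_mem hz ha hf) hf hf0
  exact fun e => hg0 ((Submodule.mem_bot F).1 (e ▸ ⟨hg, hgz _ rfl⟩))

/-- An invariant subspace in which the polynomials without `x_{m+1}` are stable under the Weyl
algebra in the other variables is trivial. -/
theorem IsInvariant.eq_top_of_posOp_mem [CharZero F] (hm : 1 ≤ m) (hS : Admissible S)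
    (ha : a zIdx = 0) (h : IsInvariant c S a N) (h0 : N ≠ ⊥)
    (hq : ∀ r, ∀ f ∈ N, f ∈ freeOf F zIdx → posOp S a (idx r) f ∈ N) : N = ⊤ := by
  have hz : zIdx ∉ S := hS.1
  have hfree : freeOf F zIdx ≤ N ⊓ freeOf F zIdx := by
    refine freeOf_le_of_stable ?_ inf_le_right ?_ ?_
    · exact h.inf_freeOf_ne_bot hz ha h0
    · rintro i hi f ⟨hf, hf'⟩
      obtain ⟨r, rfl⟩ := exists_idx_of_ne hi
      refine ⟨?_, pderiv_mem_freeOf _ hf'⟩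
      -- For an index in `S` the derivative comes from `q_r`, otherwise from `p_r`; the shift by the
      -- scalar `a` is harmless. Multiplication below is obtained from the other one.
      by_cases hr : idx r ∈ S
      · have h1 := hq r f hf hf'
        rw [posOp, if_pos hr, partialX_apply, ← smul_eq_C_mul] at h1
        exact (N.add_mem_iff_left (N.smul_mem _ hf)).1 h1
      · have h1 := h.momOp_mem hz ha r hf hf'
        rw [momOp, if_neg hr, partialX_apply, ← smul_eq_C_mul] at h1
        exact (N.add_mem_iff_left (N.smul_mem _ hf)).1 h1
    · rintro i hi f ⟨hf, hf'⟩
      obtain ⟨r, rfl⟩ := exists_idx_of_ne hi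
      refine ⟨?_, X_mul_mem_freeOf hi hf'⟩
      by_cases hr : idx r ∈ S
      · have h1 := h.momOp_mem hz ha r hf hf'
        rw [momOp, if_pos hr] at h1
        exact N.neg_mem_iff.1 h1
      · have h1 := hq r f hf hf'
        rwa [posOp, if_neg hr] at h1
  obtain ⟨r, hr⟩ := hS.exists_notMem hm
  refine eq_top_of_X_pow_mul_mem (z := zIdx) fun k => ?_
  induction k with
  | zero => exact fun f hf => by simpa using (hfree hf).1
  | succ k ih =>
    intro f hf
    -- To reach `z^(k+1) f`, write `f = p_r g` and raise `z^k g` with `r'`: the first term is `z^k`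
    -- times a polynomial free of `z`, known by induction, and the other is `± z^(k+1) f`.
    obtain ⟨g, hg, rfl⟩ := exists_momOp_eq (a := a) (idx_ne_zIdx r) hr hf
    have h1 := h.raise_mem hz r.swap (ih g hg)
    rw [shiftedEuler_X_pow_mul hz, posOp_X_pow_mul hz, Sum.swap_swap,
      momOp_X_pow_mul hz (idx_ne_zIdx r), ← mul_assoc, ← pow_succ'] at h1
    have h2 := ih _ (posOp_mem_freeOf (S := S) (a := a) (idx_ne_zIdx r.swap)
      (add_mem (shiftedEuler_mem_freeOf (c := c) hz ha hg) (Submodule.smul_mem _ (k : F) hg)))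
    exact (N.smul_mem_iff (sgn_ne_zero _)).1 ((N.add_mem_iff_right h2).1 h1)

/-- Since `p_t` is onto on `N ∩ ker ∂_z`, a relation containing `q_r p_t` gives information on `q_r`
itself. -/
theorem IsInvariant.eq_top_of_ne_zero [CharZero F] (hm : 1 ≤ m) (hS : Admissible S)
    (ha : a zIdx = 0) (h : IsInvariant c S a N) (h0 : N ≠ ⊥) {t : Fin m ⊕ Fin m}
    (ht : idx t ∉ S) (hat : a (idx t) ≠ 0) : N = ⊤ := by
  have hz : zIdx ∉ S := hS.1
  have hmom : ∀ r, ∀ f ∈ N ⊓ freeOf F zIdx, momOp S a (idx r) f ∈ N ⊓ freeOf F zIdx :=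
    fun r f hf => ⟨h.momOp_mem hz ha r hf.1 hf.2, momOp_mem_freeOf (idx_ne_zIdx r) hf.2⟩
  have hsurj : ∀ f ∈ N ⊓ freeOf F zIdx, ∃ g ∈ N ⊓ freeOf F zIdx, momOp S a (idx t) g = f := by
    intro f hf
    simp only [momOp, ht, if_false, partialX_apply]
    refine exists_pderiv_add_eq hat (fun g hg => ?_) hf
    have h1 := hmom t g hg
    rw [momOp, if_neg ht, partialX_apply, ← smul_eq_C_mul] at h1
    exact (Submodule.add_mem_iff_left _ (Submodule.smul_mem _ _ hg)).1 h1
  -- With both indices equal to `t'` the quadratic element is `± 2 q_{t'} p_t`.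
  have hj : ∀ f ∈ N ⊓ freeOf F zIdx, posOp S a (idx t.swap) f ∈ N := by
    intro f hf
    obtain ⟨g, hg, rfl⟩ := hsurj f hf
    have h1 := h.quadratic_mem t.swap t.swap hg.1
    rw [Sum.swap_swap, ← add_smul, N.smul_mem_iff] at h1
    · exact h1
    · rw [← two_mul]
      exact mul_ne_zero two_ne_zero (sgn_ne_zero _)
  refine h.eq_top_of_posOp_mem hm hS ha h0 fun r f hf hf' => ?_
  obtain ⟨g, hg, rfl⟩ := hsurj f ⟨hf, hf'⟩
  have h1 := h.quadratic_mem r t.swap hg.1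
  rw [Sum.swap_swap] at h1
  -- The other term of the relation, `q_{t'} p_{r'} g`, is already in `N` by the case `q_{t'}`.
  have h2 := N.smul_mem (sgn F r) (hj _ (hmom r.swap g hg))
  exact (N.smul_mem_iff (sgn_ne_zero _)).1 ((N.add_mem_iff_left h2).1 h1)

end Irreducibility

/-! ### Operators diagonal on monomials, and inversion of `D + c` -/

section Diagonal

theorem coeff_of_monomial_eigenvector {F : Type*} [Field F] {σ : Type*}
    {T : Module.End F (MvPolynomial σ F)} {w : (σ →₀ ℕ) → F}
    (hT : ∀ s, T (monomial s 1) = w s • monomial s 1) (s : σ →₀ ℕ) (f : MvPolynomial σ F) :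
    coeff s (T f) = w s * coeff s f := by
  classical
  induction f using MvPolynomial.induction_on' with
  | monomial u b =>
    have : monomial u b = b • (monomial u 1 : MvPolynomial σ F) := by simp [smul_monomial]
    rw [this, map_smul, hT, coeff_smul, coeff_smul, coeff_smul, coeff_monomial]
    split_ifs with h
    · rw [h, smul_eq_mul, smul_eq_mul]; simp [mul_comm]
    · simp
  | add p q hp hq => rw [map_add, coeff_add, coeff_add, hp, hq, mul_add]

/-- An operator that is diagonal on the monomials with nonzero eigenvalues is onto on every stable
subspace. -/
theorem exists_eq_of_monomial_eigenvector {F : Type*} [Field F] {σ : Type*} [Finite σ]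
    {T : Module.End F (MvPolynomial σ F)} {w : (σ →₀ ℕ) → F}
    (hT : ∀ s, T (monomial s 1) = w s • monomial s 1) (hw : ∀ s, w s ≠ 0)
    {K : Submodule F (MvPolynomial σ F)} (hK : ∀ f ∈ K, T f ∈ K) {f : MvPolynomial σ F}
    (hf : f ∈ K) : ∃ g ∈ K, T g = f := by
  -- A diagonal operator respects the degree filtration, so surjectivity follows from injectivity on
  -- a finite-dimensional piece of `K`.
  have hW : ∀ g ∈ K ⊓ restrictTotalDegree σ F f.totalDegree,
      T g ∈ K ⊓ restrictTotalDegree σ F f.totalDegree := by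
    refine fun g hg => ⟨hK g hg.1, (mem_restrictSupport_iff _).2 fun s hs =>
      (mem_restrictSupport_iff _).1 hg.2 ?_⟩
    rw [Finset.mem_coe, mem_support_iff, coeff_of_monomial_eigenvector hT] at hs
    exact mem_support_iff.2 (right_ne_zero_of_mul hs)
  have hinj : Function.Injective T := by
    rw [injective_iff_map_eq_zero]
    intro g hg
    ext s
    have := coeff_of_monomial_eigenvector hT s g
    rw [hg, coeff_zero] at this
    exact (mul_eq_zero.1 this.symm).resolve_left (hw s)
  have hfin : FiniteDimensional F
      (K ⊓ restrictTotalDegree σ F f.totalDegree : Submodule F (MvPolynomial σ F)) :=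
    Submodule.finiteDimensional_of_le inf_le_right
  have hsurj : Function.Surjective (T.restrict hW) :=
    LinearMap.injective_iff_surjective.1 fun x y hxy =>
      Subtype.ext (hinj (congrArg Subtype.val hxy))
  obtain ⟨g, hg⟩ := hsurj ⟨f, hf, (mem_restrictTotalDegree _ _ _).2 le_rfl⟩
  exact ⟨g.1, g.2.1, congrArg Subtype.val hg⟩

variable {F : Type*} [Field F] {n : ℕ}

/-- The eigenvalue of `q_i p_i` on the monomial with exponent `s`. -/
def exponent (S : Finset (Fin n)) (s : Fin n →₀ ℕ) (i : Fin n) : ℤ :=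
  if i ∈ S then -(s i + 1) else s i

theorem X_mul_pderiv_monomial_eq_smul (i : Fin n) (s : Fin n →₀ ℕ) (b : F) :
    X i * pderiv i (monomial s b) = (s i : F) • monomial s b := by
  rw [X_mul_pderiv_monomial, Nat.cast_smul_eq_nsmul]

theorem posOp_momOp_monomial (S : Finset (Fin n)) (s : Fin n →₀ ℕ) (i : Fin n) (b : F) :
    posOp S 0 i (momOp S 0 i (monomial s b)) = (exponent S s i : F) • monomial s b := by
  by_cases h : i ∈ S
  · simp only [posOp, momOp, exponent, if_pos h, LinearMap.neg_apply, map_neg, mulX,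
      LinearMap.mulLeft_apply, partialX_apply, Pi.zero_apply, C_0, zero_mul, add_zero, pderiv_mul,
      pderiv_X_self, one_mul, X_mul_pderiv_monomial_eq_smul]
    push_cast
    rw [neg_smul, add_smul, one_smul, add_comm]
  · simp only [posOp, momOp, exponent, if_neg h, mulX,
      LinearMap.mulLeft_apply, partialX_apply, Pi.zero_apply, C_0, zero_mul, add_zero,
      X_mul_pderiv_monomial_eq_smul]
    push_cast
    rfl

theorem eulerOp_monomial (S : Finset (Fin n)) (s : Fin n →₀ ℕ) (b : F) :
    eulerOp S 0 (monomial s b) = ((∑ i, exponent S s i : ℤ) : F) • monomial s b := by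
  rw [eulerOp, LinearMap.sum_apply, Int.cast_sum, Finset.sum_smul]
  exact Finset.sum_congr rfl fun i _ => posOp_momOp_monomial S s i b

theorem shiftedEuler_monomial {m : ℕ} (c : F) (S : Finset (Fin (2 * m + 1)))
    (s : Fin (2 * m + 1) →₀ ℕ) (b : F) :
    shiftedEuler c S 0 (monomial s b) =
      (((∑ i, exponent S s i : ℤ) : F) + c) • monomial s b := by
  rw [shiftedEuler_apply, eulerOp_monomial, add_smul]

variable {m : ℕ} {c : F} {S : Finset (Fin (2 * m + 1))}
  {N : Submodule F (MvPolynomial (Fin (2 * m + 1)) F)}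

/-- Write `f = (D + c) g` and `p_{r'} g = (D + c) k` inside `N ∩ ker ∂_z`. Then `q_r f = q_r (D + c)
g` differs from an element of `N` by a multiple of `z (D + c) k`, which is also in `N`. -/
theorem IsInvariant.eq_top_of_exponent_ne [CharZero F] (hm : 1 ≤ m) (hS : Admissible S)
    (h : IsInvariant c S 0 N) (h0 : N ≠ ⊥)
    (hc : ∀ s : Fin (2 * m + 1) →₀ ℕ, ((∑ i, exponent S s i : ℤ) : F) + c ≠ 0) : N = ⊤ := by
  have hz : zIdx ∉ S := hS.1
  have hsurj : ∀ f ∈ N ⊓ freeOf F zIdx, ∃ g ∈ N ⊓ freeOf F zIdx, shiftedEuler c S 0 g = f :=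
    fun f hf => exists_eq_of_monomial_eigenvector (fun s => shiftedEuler_monomial c S s 1) hc
      (fun g hg => Submodule.mem_inf.2 ⟨h.shiftedEuler_mem hz rfl hg.1 hg.2,
        shiftedEuler_mem_freeOf hz rfl hg.2⟩) hf
  refine h.eq_top_of_posOp_mem hm hS rfl h0 fun r f hf hf' => ?_
  obtain ⟨g, hg, rfl⟩ := hsurj f ⟨hf, hf'⟩
  obtain ⟨k, hk, e⟩ := hsurj _ ⟨h.momOp_mem hz rfl r.swap hg.1 hg.2,
    momOp_mem_freeOf (idx_ne_zIdx _) hg.2⟩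
  have h1 := h.raise_mem hz r hg.1
  rw [← e] at h1
  exact (N.add_mem_iff_left (N.smul_mem _ (h.X_mul_euler_mem hz hk.1))).1 h1

end Diagonal

/-! ### From invariant subspaces to irreducible Lie modules -/

section Modules

variable {F : Type*} [Field F] {m : ℕ} {c : F} {S : Finset (Fin (2 * m + 1))}
  {a : Fin (2 * m + 1) → F}

/-- A subspace of the oscillator module, as a space of polynomials. -/
def polys (W : Submodule F (OscModule c S a)) : Submodule F (MvPolynomial (Fin (2 * m + 1)) F) :=
  W

theorem isInvariant_polys (N : LieSubmodule F (Sp F m) (OscModule c S a)) :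
    IsInvariant c S a (polys N.toSubmodule) :=
  fun _ _ hf => N.lie_mem hf

instance : Nontrivial (OscModule c S a) :=
  inferInstanceAs (Nontrivial (MvPolynomial (Fin (2 * m + 1)) F))

theorem isIrreducible_of_isInvariant
    (h : ∀ N : Submodule F (MvPolynomial (Fin (2 * m + 1)) F), IsInvariant c S a N → N ≠ ⊥ → N = ⊤) :
    LieModule.IsIrreducible F (Sp F m) (OscModule c S a) := by
  refine LieModule.IsIrreducible.mk fun N hN => ?_
  have := h (polys N.toSubmodule) (isInvariant_polys N)
    fun e => hN ((LieSubmodule.toSubmodule_eq_bot N).1 e)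
  exact LieSubmodule.toSubmodule_injective this

theorem isIrreducible_empty [CharZero F] (hm : 1 ≤ m) (hc : ∀ k : ℕ, c ≠ -(k : F)) :
    LieModule.IsIrreducible F (Sp F m) (OscModule c ∅ (0 : Fin (2 * m + 1) → F)) := by
  refine isIrreducible_of_isInvariant fun N hN h0 =>
    hN.eq_top_of_exponent_ne hm (by simp [Admissible]) h0 fun s hs => hc (∑ i, s i) ?_
  simp only [exponent, Finset.notMem_empty, if_false] at hs
  push_cast at hs ⊢
  exact (neg_eq_of_add_eq_zero_right hs).symm

theorem isIrreducible_of_notMem_int [CharZero F] (hm : 1 ≤ m) (hS : Admissible S)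
    (hc : ∀ k : ℤ, c ≠ (k : F)) :
    LieModule.IsIrreducible F (Sp F m) (OscModule c S (0 : Fin (2 * m + 1) → F)) := by
  refine isIrreducible_of_isInvariant fun N hN h0 =>
    hN.eq_top_of_exponent_ne hm hS h0 fun s hs => hc (-∑ i, exponent S s i) ?_
  rw [Int.cast_neg]
  exact (neg_eq_of_add_eq_zero_right hs).symm

theorem isIrreducible_of_ne_zero [CharZero F] (hm : 1 ≤ m) (hS : Admissible S) (ha : a ≠ 0)
    (hz : a (xIdx (Fin.last m)) = 0)
    (hy : (∃ i : Fin m, yIdx i ∈ S) → ∃ i : Fin m, yIdx i ∈ S ∧ a (xIdx i.castSucc) ≠ 0)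
    (hx : (∃ j : Fin m, xIdx j.castSucc ∈ S) →
      ∃ j : Fin m, xIdx j.castSucc ∈ S ∧ a (yIdx j) ≠ 0) :
    LieModule.IsIrreducible F (Sp F m) (OscModule c S a) := by
  -- If `S` meets either half, the hypothesis makes `a` nonzero at the partner of an element of `S`,
  -- and admissibility keeps that partner out of `S`. Otherwise any nonzero coordinate of `a`
  -- serves.
  obtain ⟨t, ht, hat⟩ : ∃ t : Fin m ⊕ Fin m, idx t ∉ S ∧ a (idx t) ≠ 0 := by
    by_cases h1 : ∃ i : Fin m, yIdx i ∈ S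
    · obtain ⟨i, hi, hai⟩ := hy h1
      exact ⟨Sum.inl i, fun h => hS.2 i ⟨h, hi⟩, hai⟩
    by_cases h2 : ∃ j : Fin m, xIdx j.castSucc ∈ S
    · obtain ⟨j, hj, haj⟩ := hx h2
      exact ⟨Sum.inr j, fun h => hS.2 j ⟨hj, h⟩, haj⟩
    obtain ⟨i, hi⟩ := Function.ne_iff.1 ha
    obtain ⟨t, rfl⟩ := exists_idx_of_ne (i := i) fun e => hi (by rw [e]; exact hz)
    refine ⟨t, fun h => ?_, hi⟩
    rcases t with i | i
    · exact h2 ⟨i, h⟩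
    · exact h1 ⟨i, h⟩
  exact isIrreducible_of_isInvariant fun N hN h0 => hN.eq_top_of_ne_zero hm hS hz h0 ht hat

end Modules

/-! ### Degree and coefficient bookkeeping for monomials -/

section Monomials

variable {F : Type*} [Field F] {σ : Type*}

theorem pderiv_monomial_add_single (i : σ) (s : σ →₀ ℕ) (b : F) :
    pderiv i (monomial (s + Finsupp.single i 1) b) = ((s i : F) + 1) • monomial s b := by
  classical
  rw [pderiv_monomial, add_tsub_cancel_right, smul_monomial]
  simp [mul_comm]

theorem exists_eq_add_single {s : σ →₀ ℕ} {i : σ} (h : s i ≠ 0) :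
    ∃ u : σ →₀ ℕ, s = u + Finsupp.single i 1 :=
  ⟨s - Finsupp.single i 1,
    (tsub_add_cancel_of_le (by simpa [Nat.one_le_iff_ne_zero] using h)).symm⟩

theorem exists_ne_zero_of_degree {s : σ →₀ ℕ} (h : s.degree ≠ 0) : ∃ i, s i ≠ 0 := by
  by_contra! hall
  exact h (by rw [show s = 0 from Finsupp.ext hall, map_zero])

theorem monomial_mem {N : Submodule F (MvPolynomial σ F)} {s : σ →₀ ℕ}
    (h : monomial s 1 ∈ N) (b : F) : monomial s b ∈ N := by
  have := N.smul_mem b h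
  rwa [smul_monomial, smul_eq_mul, mul_one] at this

theorem coeff_X_mul_pderiv (i : σ) (s : σ →₀ ℕ) (f : MvPolynomial σ F) :
    coeff s (X i * pderiv i f) = s i * coeff s f :=
  coeff_of_monomial_eigenvector (T := LinearMap.mulLeft F (X i) ∘ₗ (pderiv i).toLinearMap)
    (w := fun s => (s i : F))
    (fun s => by
      change X i * pderiv i (monomial s (1 : F)) = (s i : F) • monomial s 1
      rw [MvPolynomial.X_mul_pderiv_monomial, Nat.cast_smul_eq_nsmul]) s f

theorem mem_of_forall_monomial_mem {N : Submodule F (MvPolynomial σ F)} {f : MvPolynomial σ F}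
    (h : ∀ s : σ →₀ ℕ, s.degree ≤ f.totalDegree → monomial s 1 ∈ N) : f ∈ N := by
  rw [f.as_sum]
  exact Submodule.sum_mem _ fun s hs => monomial_mem (h s (le_totalDegree hs)) _

theorem totalDegree_pderiv_le {i : σ} {f : MvPolynomial σ F} {k : ℕ} (h : f.totalDegree ≤ k + 1) :
    (pderiv i f).totalDegree ≤ k := by
  by_cases h0 : pderiv i f = 0
  · simp [h0]
  · have := totalDegree_pderiv_lt h0
    omega

theorem totalDegree_X_mul_le (i : σ) {f : MvPolynomial σ F} {k : ℕ} (h : f.totalDegree ≤ k) :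
    (X i * f).totalDegree ≤ k + 1 := by
  have := totalDegree_mul (X i) f
  rw [totalDegree_X] at this
  omega

theorem exists_idx_apply_ne_zero {m : ℕ} {s : Fin (2 * m + 1) →₀ ℕ} (hz : s zIdx = 0)
    {x : Fin (2 * m + 1)} (h : s x ≠ s.degree) : ∃ t, idx t ≠ x ∧ s (idx t) ≠ 0 := by
  by_contra! hall
  refine h ?_
  rw [Finsupp.degree_eq_sum, Finset.sum_eq_single x (fun i _ hi => ?_) (by simp)]
  rcases eq_zIdx_or_exists_idx i with rfl | ⟨t, rfl⟩
  · exact hz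
  · exact hall t hi

end Monomials

/-! ### The case `S = ∅`, `a = 0`: submodules when `c = -ℓ` -/

section Untwisted

variable {F : Type*} [Field F] {m : ℕ} {c : F}
  {N : Submodule F (MvPolynomial (Fin (2 * m + 1)) F)}

theorem posOp_empty {n : ℕ} (i : Fin n) (f : MvPolynomial (Fin n) F) :
    posOp ∅ 0 i f = X i * f := by
  simp [posOp, mulX]

theorem momOp_empty {n : ℕ} (i : Fin n) (f : MvPolynomial (Fin n) F) :
    momOp ∅ 0 i f = pderiv i f := by
  simp [momOp, partialX_apply]

theorem shiftedEuler_empty_monomial (s : Fin (2 * m + 1) →₀ ℕ) (b : F) :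
    shiftedEuler c ∅ 0 (monomial s b) = ((s.degree : F) + c) • monomial s b := by
  rw [shiftedEuler_monomial, Finsupp.degree_eq_sum]
  simp [exponent]

theorem IsInvariant.empty_quadratic_mem (h : IsInvariant c ∅ 0 N) (r t : Fin m ⊕ Fin m)
    {f : MvPolynomial (Fin (2 * m + 1)) F} (hf : f ∈ N) :
    sgn F t • (X (idx r) * pderiv (idx t.swap) f) +
      sgn F r • (X (idx t) * pderiv (idx r.swap) f) ∈ N := by
  simpa only [posOp_empty, momOp_empty] using h.quadratic_mem r t hf

theorem IsInvariant.empty_lower_mem (h : IsInvariant c ∅ 0 N) (r : Fin m ⊕ Fin m)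
    {f : MvPolynomial (Fin (2 * m + 1)) F} (hf : f ∈ N) :
    X (idx r) * pderiv zIdx f + sgn F r • pderiv (idx r.swap) f ∈ N := by
  simpa only [posOp_empty, momOp_empty] using h.lower_mem (Finset.notMem_empty _) rfl r hf

theorem IsInvariant.empty_raise_mem (h : IsInvariant c ∅ 0 N) (r : Fin m ⊕ Fin m)
    {s : Fin (2 * m + 1) →₀ ℕ} (hs : monomial s 1 ∈ N) :
    ((s.degree : F) + c) • monomial (s + Finsupp.single (idx r) 1) 1 +
      sgn F r • (X zIdx * pderiv (idx r.swap) (monomial s 1)) ∈ N := by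
  have := h.raise_mem (Finset.notMem_empty _) r hs
  rwa [shiftedEuler_empty_monomial, map_smul, posOp_empty, momOp_empty, X_mul_monomial] at this

/-- From all monomials of degree `k` one reaches those of degree `k + 1`, unless `c = -k`. -/
theorem IsInvariant.monomial_mem_succ [CharZero F] (h : IsInvariant c ∅ 0 N) {k : ℕ}
    (hk : ∀ s : Fin (2 * m + 1) →₀ ℕ, s.degree = k → monomial s 1 ∈ N) (hc : (k : F) + c ≠ 0)
    (s : Fin (2 * m + 1) →₀ ℕ) (hs : s.degree = k + 1) : monomial s 1 ∈ N := by
  classical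
  obtain ⟨i, hi⟩ := exists_ne_zero_of_degree (s := s) (by omega)
  obtain ⟨u, rfl⟩ := exists_eq_add_single hi
  have hu : u.degree = k := by rw [degree_add_single] at hs; omega
  rcases eq_zIdx_or_exists_idx i with rfl | ⟨r, rfl⟩
  · have h1 := h.X_mul_euler_mem (Finset.notMem_empty _) (hk u hu)
    rw [shiftedEuler_empty_monomial, mul_smul_comm, X_mul_monomial, hu] at h1
    exact (N.smul_mem_iff hc).1 h1
  · have h1 := h.empty_raise_mem r (hk u hu)
    rw [hu] at h1
    refine (N.smul_mem_iff hc).1 ((N.add_mem_iff_left (N.smul_mem _ ?_)).1 h1)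
    -- The correction `z ∂_{r'}` preserves the degree, so it stays among the monomials of degree
    -- `k`.
    by_cases h0 : u (idx r.swap) = 0
    · simp [pderiv_monomial, h0]
    · obtain ⟨v, rfl⟩ := exists_eq_add_single h0
      rw [pderiv_monomial_add_single, mul_smul_comm, X_mul_monomial]
      refine N.smul_mem _ (hk _ ?_)
      rw [degree_add_single] at hu ⊢
      exact hu

theorem IsInvariant.one_mem [CharZero F] (h : IsInvariant c ∅ 0 N) (h0 : N ≠ ⊥) :
    (1 : MvPolynomial (Fin (2 * m + 1)) F) ∈ N := by
  have hz : (zIdx : Fin (2 * m + 1)) ∉ (∅ : Finset (Fin (2 * m + 1))) := Finset.notMem_empty _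
  refine (one_mem_of_forall_pderiv_mem (N := N ⊓ freeOf F zIdx) (fun i f hf => ?_)
    (h.inf_freeOf_ne_bot hz rfl h0)).1
  refine ⟨?_, pderiv_mem_freeOf i hf.2⟩
  rcases eq_zIdx_or_exists_idx i with rfl | ⟨r, rfl⟩
  · exact h.pderiv_mem hz rfl hf.1
  · rw [← momOp_empty]
    exact h.momOp_mem hz rfl r hf.1 hf.2

variable {l : ℕ}

theorem natCast_add_neg_ne_zero [CharZero F] {k : ℕ} (h : k ≠ l) : (k : F) + -(l : F) ≠ 0 := by
  rw [← sub_eq_add_neg, sub_ne_zero]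
  exact_mod_cast h

/-- A nonzero invariant subspace contains all polynomials of degree at most `l`, if `c = -l`. -/
theorem IsInvariant.mem_of_totalDegree_le [CharZero F] (h : IsInvariant (-(l : F)) ∅ 0 N)
    (h0 : N ≠ ⊥) {f : MvPolynomial (Fin (2 * m + 1)) F} (hf : f.totalDegree ≤ l) : f ∈ N := by
  have hk : ∀ k ≤ l, ∀ s : Fin (2 * m + 1) →₀ ℕ, s.degree = k → monomial s 1 ∈ N := by
    intro k
    induction k with
    | zero =>
      intro _ s hs
      rw [Finsupp.degree_eq_zero_iff] at hs
      rw [hs]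
      exact h.one_mem h0
    | succ k ih =>
      exact fun hkl => h.monomial_mem_succ (ih (by omega)) (natCast_add_neg_ne_zero (by omega))
  exact mem_of_forall_monomial_mem fun s hs => hk _ (hs.trans hf) s rfl

theorem IsInvariant.eq_top_of_degree_eq_succ [CharZero F] (h : IsInvariant (-(l : F)) ∅ 0 N)
    (hl : ∀ f : MvPolynomial (Fin (2 * m + 1)) F, f.totalDegree ≤ l → f ∈ N)
    (hs : ∀ s : Fin (2 * m + 1) →₀ ℕ, s.degree = l + 1 → monomial s 1 ∈ N) : N = ⊤ := by
  have hk : ∀ k, ∀ s : Fin (2 * m + 1) →₀ ℕ, s.degree = l + 1 + k → monomial s 1 ∈ N := by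
    intro k
    induction k with
    | zero => exact hs
    | succ k ih => exact h.monomial_mem_succ ih (natCast_add_neg_ne_zero (by omega : l + 1 + k ≠ l))
  refine Submodule.eq_top_iff'.2 fun f => mem_of_forall_monomial_mem fun s _ => ?_
  rcases le_or_gt s.degree l with h1 | h1
  · exact hl _ ((totalDegree_monomial s one_ne_zero).trans_le h1)
  · exact hk (s.degree - (l + 1)) s (by omega)

/-- If `c = -l`, an invariant subspace with elements of degree greater than `l` has an element of
degree `l + 1`. -/
theorem IsInvariant.exists_totalDegree_eq [CharZero F] (h : IsInvariant c ∅ 0 N)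
    {f : MvPolynomial (Fin (2 * m + 1)) F} (hf : f ∈ N) (hfl : l < f.totalDegree) :
    ∃ g ∈ N, g.totalDegree = l + 1 := by
  induction hd : f.totalDegree using Nat.strong_induction_on generalizing f with
  | _ d ih =>
    subst hd
    by_cases hd : f.totalDegree = l + 1
    · exact ⟨f, hf, hd⟩
    -- If no element has degree `l + 1`, every element of `N` of degree below that of `f` must have
    -- degree at most `l`. Applied to `∂_z f` and `x_r ∂_z f ± ∂_{r'} f`, this annihilates the
    -- leading coefficients of `f`.
    have hstep : ∀ g ∈ N, g.totalDegree < f.totalDegree →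
        (∃ g ∈ N, g.totalDegree = l + 1) ∨ g.totalDegree ≤ l := by
      intro g hg hlt
      rcases le_or_gt g.totalDegree l with h1 | h1
      · exact Or.inr h1
      · exact Or.inl (ih _ hlt hg h1 rfl)
    by_contra hne
    have hz : (pderiv zIdx f).totalDegree ≤ l := by
      by_cases h0 : pderiv zIdx f = 0
      · simp [h0]
      · exact (hstep _ (h.pderiv_mem (Finset.notMem_empty _) rfl hf)
          (totalDegree_pderiv_lt h0)).resolve_left hne
    have hr : ∀ r, (X (idx r) * pderiv zIdx f +
        sgn F r • pderiv (idx r.swap) f).totalDegree ≤ l := by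
      intro r
      refine (hstep _ (h.empty_lower_mem r hf) ?_).resolve_left hne
      refine (totalDegree_add _ _).trans_lt (max_lt ?_ ((totalDegree_smul_le _ _).trans_lt ?_))
      · exact (totalDegree_X_mul_le _ hz).trans_lt (by omega)
      · have : (pderiv (idx r.swap) f).totalDegree ≤ f.totalDegree - 1 :=
          totalDegree_pderiv_le (by omega)
        omega
    obtain ⟨s, hs, hsd⟩ := Finset.exists_mem_eq_sup f.support
      (by rw [support_nonempty]; rintro rfl; simp at hfl) (fun s => s.degree)
    have hsd' : l + 1 < s.degree := by
      have : f.totalDegree = s.degree := hsd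
      omega
    have hcoeff : ∀ g : MvPolynomial (Fin (2 * m + 1)) F, g.totalDegree ≤ l + 1 →
        coeff s g = 0 := by
      intro g hg
      by_contra hc
      have := le_totalDegree (mem_support_iff.2 hc)
      change s.degree ≤ _ at this
      omega
    obtain ⟨i, hi⟩ := exists_ne_zero_of_degree (s := s) (by omega)
    rcases eq_zIdx_or_exists_idx i with rfl | ⟨r, rfl⟩
    · have h1 := hcoeff _ (totalDegree_X_mul_le zIdx hz)
      rw [coeff_X_mul_pderiv] at h1
      exact mul_ne_zero (by exact_mod_cast hi) (mem_support_iff.1 hs) h1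
    -- Multiply the operators for `r'` and `r` by `x_r` and `x_{r'}`: the terms `x_r x_{r'} ∂_z f`
    -- cancel in the difference, leaving `± (s_r + s_{r'})` times the coefficient of the leading
    -- monomial `s`.
    · have h1 := hcoeff _ (totalDegree_X_mul_le (idx r) (hr r.swap))
      have h2 := hcoeff _ (totalDegree_X_mul_le (idx r.swap) (hr r))
      rw [mul_add, coeff_add, mul_smul_comm, coeff_smul, Sum.swap_swap, coeff_X_mul_pderiv,
        mul_left_comm, smul_eq_mul, sgn_swap] at h1
      rw [mul_add, coeff_add, mul_smul_comm, coeff_smul, coeff_X_mul_pderiv, smul_eq_mul] at h2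
      have h3 : sgn F r * (((s (idx r) + s (idx r.swap) : ℕ) : F) * coeff s f) = 0 := by
        push_cast
        linear_combination h2 - h1
      refine mul_ne_zero (sgn_ne_zero r) (mul_ne_zero ?_ (mem_support_iff.1 hs)) h3
      exact_mod_cast (by omega : s (idx r) + s (idx r.swap) ≠ 0)

/-- All terms below the top degree already lie in `N` and can be subtracted. -/
theorem exists_isHomogeneous_mem (hl : ∀ f : MvPolynomial (Fin (2 * m + 1)) F,
    f.totalDegree ≤ l → f ∈ N) {f : MvPolynomial (Fin (2 * m + 1)) F} (hf : f ∈ N)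
    (hd : f.totalDegree = l + 1) : ∃ g ∈ N, g ≠ 0 ∧ g.IsHomogeneous (l + 1) := by
  refine ⟨homogeneousComponent (l + 1) f, ?_, ?_, homogeneousComponent_isHomogeneous _ _⟩
  · rw [← sub_sub_cancel f (homogeneousComponent (l + 1) f)]
    refine N.sub_mem hf (hl _ (Finset.sup_le fun s hs => ?_))
    rw [mem_support_iff, coeff_sub, coeff_homogeneousComponent] at hs
    change s.degree ≤ l
    split_ifs at hs with h1
    · simp at hs
    · rw [sub_zero] at hs
      have := le_totalDegree (mem_support_iff.2 hs)
      change s.degree ≤ _ at this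
      omega
  · intro h0
    obtain ⟨s, hs, hsd⟩ := Finset.exists_mem_eq_sup f.support
      (by rw [support_nonempty]; rintro rfl; simp at hd) (fun s => s.degree)
    have h1 := coeff_homogeneousComponent (l + 1) f s
    rw [if_pos (by rw [← hd]; exact hsd.symm), h0, coeff_zero] at h1
    exact mem_support_iff.1 hs h1.symm

/-- Each step trades a factor of `g` for a factor `x_r`: apply an operator `x_r ∂_i` with `∂_i g ≠
0`, available modulo `N`, and pass from `x_r^e g` to `x_r^(e+1) ∂_i g`. The order in which `i` is
tried makes the companion terms vanish. -/
theorem IsInvariant.X_pow_mem [CharZero F] (h : IsInvariant c ∅ 0 N)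
    (hl : ∀ f : MvPolynomial (Fin (2 * m + 1)) F, f.totalDegree ≤ l → f ∈ N)
    (r : Fin m ⊕ Fin m) (k : ℕ) (e : ℕ) (hke : e + k = l + 1)
    {g : MvPolynomial (Fin (2 * m + 1)) F} (hg : g.IsHomogeneous k) (hg0 : g ≠ 0)
    (hN : X (idx r) ^ e * g ∈ N) : X (idx r) ^ (l + 1) ∈ N := by
  induction k generalizing e g with
  | zero =>
    rw [← totalDegree_zero_iff_isHomogeneous, totalDegree_eq_zero_iff_eq_C] at hg
    rw [hg, mul_comm (X _ ^ _), ← smul_eq_C_mul] at hN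
    rw [(by omega : l + 1 = e)]
    exact (N.smul_mem_iff fun h0 => hg0 (by rw [hg, h0, C_0])).1 hN
  | succ k ih =>
    have hder : ∀ i ≠ idx r, pderiv i (X (idx r) ^ e * g) = X (idx r) ^ e * pderiv i g := by
      intro i hi
      rw [pderiv_mul, pderiv_pow, pderiv_X_of_ne hi.symm]
      simp
    have hstep : ∀ i, pderiv i g ≠ 0 → X (idx r) ^ (e + 1) * pderiv i g ∈ N →
        X (idx r) ^ (l + 1) ∈ N := fun i h0 h1 => ih (e + 1) (by omega) hg.pderiv h0 h1
    -- Plain derivatives drop to degree at most `l`, so in the lowering operator only `x_r ∂_z`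
    -- matters.
    have hlow : ∀ i, pderiv i (X (idx r) ^ e * g) ∈ N := fun i =>
      hl _ (totalDegree_pderiv_le
        ((((isHomogeneous_X_pow (R := F) (idx r) e).mul hg).totalDegree_le).trans hke.le))
    by_cases h1 : pderiv zIdx g = 0
    swap
    · refine hstep _ h1 ?_
      have h2 := h.empty_lower_mem r hN
      rw [N.add_mem_iff_left (N.smul_mem _ (hlow _)), hder _ (idx_ne_zIdx r).symm, ← mul_assoc,
        ← pow_succ'] at h2
      exact h2
    have hrr : idx r.swap ≠ idx r := fun e => by
      have := idx_injective e
      rcases r with r | r <;> simp at this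
    by_cases h2 : pderiv (idx r.swap) g = 0
    swap
    · refine hstep _ h2 ?_
      have h3 := h.empty_quadratic_mem r r hN
      rw [← add_smul, ← two_mul, N.smul_mem_iff (mul_ne_zero two_ne_zero (sgn_ne_zero r)),
        hder _ hrr, ← mul_assoc, ← pow_succ'] at h3
      exact h3
    by_cases h3 : ∃ t, idx t ≠ idx r ∧ pderiv (idx t) g ≠ 0
    · obtain ⟨t, htr, ht⟩ := h3
      refine hstep _ ht ?_
      have h4 := h.empty_quadratic_mem r t.swap hN
      rw [Sum.swap_swap, hder _ hrr, h2, mul_zero, mul_zero, smul_zero, add_zero,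
        N.smul_mem_iff (sgn_ne_zero _), hder _ htr, ← mul_assoc, ← pow_succ'] at h4
      exact h4
    -- Now only `∂_r g` can be nonzero, and Euler's identity makes `x_r ∂_r g` a nonzero multiple of
    -- `g`.
    · push Not at h3
      have h4 := hg.sum_X_mul_pderiv
      rw [Finset.sum_eq_single (idx r) (fun i _ hi => ?_) (by simp)] at h4
      · refine hstep (idx r) (fun h0 => ?_) ?_
        · rw [h0, mul_zero] at h4
          exact smul_ne_zero (Nat.succ_ne_zero k) hg0 h4.symm
        · rw [pow_succ, mul_assoc, h4, mul_smul_comm]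
          exact N.nsmul_mem hN _
      · rcases eq_zIdx_or_exists_idx i with rfl | ⟨t, rfl⟩
        · rw [h1, mul_zero]
        · rw [h3 t hi, mul_zero]

/-- The quadratic operators move `x_r^l` to every monomial of degree `l` free of `z`, by induction
on the number `k` of factors other than `x_r`. -/
theorem IsInvariant.monomial_mem_of_free [CharZero F] (h : IsInvariant c ∅ 0 N)
    (r : Fin m ⊕ Fin m) (hr : X (idx r) ^ l ∈ N) (k : ℕ)
    (s : Fin (2 * m + 1) →₀ ℕ) (hz : s zIdx = 0) (hs : s.degree = l) (hk : s (idx r) + k = l) :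
    monomial s 1 ∈ N := by
  classical
  induction k generalizing s with
  | zero =>
    have : s = Finsupp.single (idx r) l := by
      ext i
      rw [Finsupp.single_apply]
      split_ifs with hi
      · rw [← hi]; omega
      · by_contra h0
        obtain ⟨u, rfl⟩ := exists_eq_add_single h0
        have h1 := Finsupp.le_degree (idx r) u
        rw [degree_add_single] at hs
        simp only [Finsupp.add_apply, Finsupp.single_apply, if_neg (Ne.symm hi)] at hk
        omega
    rw [this, ← X_pow_eq_monomial]
    exact hr
  | succ k ih =>
    obtain ⟨t, htr, ht⟩ := exists_idx_apply_ne_zero hz (x := idx r) (by omega)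
    obtain ⟨u, rfl⟩ := exists_eq_add_single ht
    have hzt := (idx_ne_zIdx t).symm
    have hzr := (idx_ne_zIdx r).symm
    rw [degree_add_single] at hs
    simp only [Finsupp.add_apply, Finsupp.single_apply, if_neg hzt.symm, if_neg htr,
      add_zero] at hz hk
    have hmem : monomial (u + Finsupp.single (idx r) 1) 1 ∈ N := by
      refine ih _ ?_ ?_ ?_
      · simp [hz, hzr.symm]
      · rw [degree_add_single, hs]
      · simp only [Finsupp.add_apply, Finsupp.single_eq_same]; omega
    -- The term `x_t ∂_r` turns one `x_r` into the missing `x_t`. Its companion `x_{r'} ∂_{t'}`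
    -- coincides with it if `t = r'`, and otherwise leaves the exponent of `x_r` unchanged, so the
    -- induction hypothesis covers it.
    have hmain := h.empty_quadratic_mem t r.swap hmem
    rw [Sum.swap_swap, pderiv_monomial_add_single, mul_smul_comm, X_mul_monomial] at hmain
    have hu : ((u (idx r) : F) + 1) ≠ 0 := Nat.cast_add_one_ne_zero _
    by_cases htr' : t = r.swap
    · subst htr'
      rw [Sum.swap_swap, pderiv_monomial_add_single, mul_smul_comm, X_mul_monomial, ← add_smul,
        N.smul_mem_iff, N.smul_mem_iff hu] at hmain
      · exact hmain
      · rw [← two_mul]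
        exact mul_ne_zero two_ne_zero (sgn_ne_zero _)
    · have htr2 : idx r ≠ idx t.swap := fun e => htr' (by
        rw [idx_injective e, Sum.swap_swap])
      have hsec : X (idx r.swap) * pderiv (idx t.swap)
          (monomial (u + Finsupp.single (idx r) 1) (1 : F)) ∈ N := by
        by_cases h0 : u (idx t.swap) = 0
        · simp [pderiv_monomial, h0, htr2]
        · obtain ⟨v, rfl⟩ := exists_eq_add_single h0
          rw [add_right_comm, pderiv_monomial_add_single, mul_smul_comm, X_mul_monomial]
          have hrr : idx r.swap ≠ idx r := fun e => by
            have := idx_injective e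
            rcases r with r | r <;> simp at this
          refine N.smul_mem _ (ih _ ?_ ?_ ?_)
          · simpa [Finsupp.single_apply, idx_ne_zIdx] using hz
          · rw [degree_add_single] at hs
            rw [degree_add_single, degree_add_single]
            omega
          · simp only [Finsupp.add_apply, Finsupp.single_apply, if_neg hrr,
              if_neg htr2.symm] at hk ⊢
            simp only [if_true]
            omega
      rw [N.add_mem_iff_left (N.smul_mem _ hsec), N.smul_mem_iff (sgn_ne_zero _),
        N.smul_mem_iff hu] at hmain
      exact hmain

/-- For `u` of degree `l`, raising `u x_{r'}` by `r` and `u x_r` by `r'` gives the same term `u x_r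
x_{r'}` of degree `l + 2`; the difference is a multiple of `u z`. -/
theorem IsInvariant.monomial_mem_of_degree_eq [CharZero F] (h : IsInvariant (-(l : F)) ∅ 0 N)
    (r : Fin m ⊕ Fin m)
    (h0 : ∀ s : Fin (2 * m + 1) →₀ ℕ, s zIdx = 0 → s.degree = l + 1 → monomial s 1 ∈ N) (k : ℕ)
    (s : Fin (2 * m + 1) →₀ ℕ) (hk : s zIdx = k) (hs : s.degree = l + 1) : monomial s 1 ∈ N := by
  classical
  induction k generalizing s with
  | zero => exact h0 s hk hs
  | succ k ih =>
    obtain ⟨u, rfl⟩ := exists_eq_add_single (s := s) (i := zIdx) (by omega)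
    rw [degree_add_single] at hs
    simp only [Finsupp.add_apply, Finsupp.single_eq_same] at hk
    have hv : ∀ r, ((l + 1 : ℕ) + -(l : F)) • monomial (u + Finsupp.single (idx r.swap) 1 +
        Finsupp.single (idx r) 1) 1 + sgn F r • (((u (idx r.swap) : F) + 1) •
          monomial (u + Finsupp.single zIdx 1) 1) ∈ N := by
      intro r
      have hd : (u + Finsupp.single (idx r.swap) 1).degree = l + 1 := by
        rw [degree_add_single, hs]
      have h1 := h.empty_raise_mem r (ih (u + Finsupp.single (idx r.swap) 1)
        (by simp [idx_ne_zIdx]; omega) hd)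
      rwa [hd, pderiv_monomial_add_single, mul_smul_comm, X_mul_monomial] at h1
    have h1 := N.sub_mem (hv r) (hv r.swap)
    rw [Sum.swap_swap, add_right_comm u, sgn_swap, add_sub_add_left_eq_sub, ← smul_assoc,
      ← smul_assoc, ← sub_smul] at h1
    refine (N.smul_mem_iff ?_).1 h1
    -- The two signs are opposite, so the coefficients add up to `u_r + u_{r'} + 2 ≠ 0` instead of
    -- cancelling.
    have h2 : sgn F r • ((u (idx r.swap) : F) + 1) - -sgn F r • ((u (idx r) : F) + 1) =
        sgn F r * ((u (idx r.swap) + u (idx r) + 1 : ℕ) + 1) := by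
      push_cast
      simp only [smul_eq_mul]
      ring
    rw [h2]
    exact mul_ne_zero (sgn_ne_zero r) (Nat.cast_add_one_ne_zero _)

/-- If `c = -l`, an invariant subspace that contains the polynomials of degree at most `l` and one
of greater degree contains all polynomials. -/
theorem IsInvariant.eq_top_of_lt_totalDegree [CharZero F] (hm : 1 ≤ m)
    (h : IsInvariant (-(l : F)) ∅ 0 N)
    (hl : ∀ f : MvPolynomial (Fin (2 * m + 1)) F, f.totalDegree ≤ l → f ∈ N)
    {f : MvPolynomial (Fin (2 * m + 1)) F} (hf : f ∈ N) (hfl : l < f.totalDegree) : N = ⊤ := by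
  obtain ⟨f', hf', hd⟩ := h.exists_totalDegree_eq hf hfl
  obtain ⟨g, hg, hg0, hgh⟩ := exists_isHomogeneous_mem hl hf' hd
  have r : Fin m ⊕ Fin m := Sum.inl ⟨0, hm⟩
  have hX := h.X_pow_mem hl r (l + 1) 0 (zero_add _) hgh hg0 (by simpa using hg)
  refine h.eq_top_of_degree_eq_succ hl fun s hs =>
    h.monomial_mem_of_degree_eq r (fun u hz hu => ?_) _ s rfl hs
  have := Finsupp.le_degree (idx r) u
  exact h.monomial_mem_of_free r hX (l + 1 - u (idx r)) u hz hu (by omega)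

end Untwisted

/-! ### Diagonal matrices and sums over matrix entries -/

section DiagonalMatrices

variable {F : Type*} [Field F] {m : ℕ}

variable (F m) in
theorem diagonal_mem_sp (d : Fin (m + 1) → F) :
    Matrix.diagonal (Sum.elim d (-d)) ∈ LieAlgebra.Symplectic.sp (Fin (m + 1)) F := by
  refine (mem_skewAdjointMatricesSubmodule _ _).2 ?_
  change Matrix.transpose _ * _ = _ * -_
  rw [Matrix.diagonal_transpose]
  ext i j
  rw [Matrix.mul_neg, Matrix.diagonal_mul, Matrix.neg_apply, Matrix.mul_diagonal]
  rcases i with i | i <;> rcases j with j | j <;>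
    simp only [Matrix.J, Matrix.fromBlocks_apply₁₁, Matrix.fromBlocks_apply₁₂,
      Matrix.fromBlocks_apply₂₁, Matrix.fromBlocks_apply₂₂, Matrix.zero_apply, Matrix.neg_apply,
      Matrix.one_apply, Sum.elim_inl, Sum.elim_inr, Pi.neg_apply] <;>
    (try split_ifs with h) <;> simp [*]

/-- The diagonal matrix in `sp(2m+2, F)` on which `eps F i` takes the value `d i`. -/
def diagElt (d : Fin (m + 1) → F) : cartan F m :=
  ⟨⟨Matrix.diagonal (Sum.elim d (-d)), diagonal_mem_sp F m d⟩, Matrix.isDiag_diagonal _⟩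

theorem eps_apply (i : Fin (m + 1)) (h : cartan F m) :
    eps F i h = h.1.1 (Sum.inl i) (Sum.inl i) := rfl

theorem eps_diagElt (d : Fin (m + 1) → F) (i : Fin (m + 1)) : eps F i (diagElt d) = d i := by
  simp [eps_apply, diagElt]

theorem apply_inr_inr (A : Sp F m) (i j : Fin (m + 1)) :
    A.1 (Sum.inr i) (Sum.inr j) = -A.1 (Sum.inl j) (Sum.inl i) := by
  have h1 := congrFun (congrFun ((mem_skewAdjointMatricesSubmodule (J := Matrix.J (Fin (m + 1)) F)
    (A₁ := A.1)).1 A.2) (Sum.inl i)) (Sum.inr j)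
  simp only [Matrix.J, Matrix.mul_apply, Fintype.sum_sum_type, Matrix.transpose_apply,
    Matrix.fromBlocks_apply₁₁, Matrix.fromBlocks_apply₁₂, Matrix.fromBlocks_apply₂₂,
    Matrix.zero_apply, Matrix.neg_apply, Matrix.one_apply] at h1
  simp at h1
  exact h1.symm

theorem matRep_reindex_apply (c : F) (S : Finset (Fin (2 * m + 1))) (a : Fin (2 * m + 1) → F)
    (A : Matrix (Fin (m + 1) ⊕ Fin (m + 1)) (Fin (m + 1) ⊕ Fin (m + 1)) F)
    (f : MvPolynomial (Fin (2 * m + 1)) F) :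
    matRep c S a (Matrix.reindex (blockEquiv m) (blockEquiv m) A) f =
      ∑ i, ∑ j, A i j • matOp c S a (blockEquiv m i) (blockEquiv m j) f := by
  change (∑ i, ∑ j, A ((blockEquiv m).symm i) ((blockEquiv m).symm j) • matOp c S a i j) f = _
  rw [← (blockEquiv m).sum_comp, LinearMap.sum_apply]
  refine Finset.sum_congr rfl fun i _ => ?_
  rw [← (blockEquiv m).sum_comp, LinearMap.sum_apply]
  simp

theorem sum_split {R : Type*} [AddCommMonoid R] (g : Fin (2 * m + 1) → R) :
    ∑ j, g j = g zIdx + ∑ i : Fin m, (g (idx (Sum.inl i)) + g (idx (Sum.inr i))) := by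
  have hb : Function.Bijective
      (fun o : Option (Fin m ⊕ Fin m) => (o.elim zIdx idx : Fin (2 * m + 1))) := by
    constructor
    · rintro (_ | r) (_ | t) h
      · rfl
      · exact absurd h.symm (idx_ne_zIdx t)
      · exact absurd h (idx_ne_zIdx r)
      · exact congrArg some (idx_injective h)
    · intro i
      rcases eq_zIdx_or_exists_idx i with rfl | ⟨r, rfl⟩
      · exact ⟨none, rfl⟩
      · exact ⟨some r, rfl⟩
  rw [← hb.sum_comp, Fintype.sum_option, Fintype.sum_sum_type, Finset.sum_add_distrib]
  rfl

end DiagonalMatrices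

/-! ### Weights of monomials and finiteness of weight spaces -/

section WeightModules

variable {F : Type*} [Field F] {m : ℕ}

/-- The weight of the monomial with exponent `s`. -/
noncomputable def monomialWeight (c : F) (S : Finset (Fin (2 * m + 1)))
    (s : Fin (2 * m + 1) →₀ ℕ) : Module.Dual F (cartan F m) :=
  ∑ i : Fin m, ((exponent S s (idx (Sum.inl i)) - exponent S s (idx (Sum.inr i)) : ℤ) : F) •
      eps F i.castSucc +
    (((exponent S s zIdx + ∑ j, exponent S s j : ℤ) : F) + c) • eps F (Fin.last m)

theorem matOp_diag_monomial (c : F) (S : Finset (Fin (2 * m + 1))) (i : Fin (2 * m + 1))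
    (s : Fin (2 * m + 1) →₀ ℕ) (b : F) :
    matOp c S 0 i.castSucc i.castSucc (monomial s b) = (exponent S s i : F) • monomial s b := by
  rw [matOp, leftOp, rightOp, Fin.snoc_castSucc, Fin.snoc_castSucc]
  exact posOp_momOp_monomial S s i b

theorem matOp_last_monomial (c : F) (S : Finset (Fin (2 * m + 1)))
    (s : Fin (2 * m + 1) →₀ ℕ) (b : F) :
    matOp c S 0 (Fin.last _) (Fin.last _) (monomial s b) =
      -((((∑ j, exponent S s j : ℤ) : F) + c) • monomial s b) := by
  rw [matOp, leftOp, rightOp, Fin.snoc_last, Fin.snoc_last, ← shiftedEuler_monomial]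
  rfl

theorem cartan_apply_of_ne (h : cartan F m) {i j : Fin (m + 1) ⊕ Fin (m + 1)} (hij : i ≠ j) :
    h.1.1 i j = 0 :=
  h.2 hij

/-- The entries in the second block are the negatives of those in the first, so `q_i p_i` and
`q_{i'} p_{i'}` enter by their difference, while `-(D + c)` enters with a second minus sign next to
`q_z p_z`. -/
theorem lie_monomial (c : F) (S : Finset (Fin (2 * m + 1))) (h : cartan F m)
    (s : Fin (2 * m + 1) →₀ ℕ) (b : F) :
    matRep c S 0 (Matrix.reindex (blockEquiv m) (blockEquiv m) h.1.1) (monomial s b) =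
      monomialWeight c S s h • monomial s b := by
  have hoff : ∀ i, ∑ j, h.1.1 i j • matOp c S 0 (blockEquiv m i) (blockEquiv m j) (monomial s b) =
      h.1.1 i i • matOp c S 0 (blockEquiv m i) (blockEquiv m i) (monomial s b) := by
    intro i
    rw [Finset.sum_eq_single i (fun j _ hj => ?_) (by simp)]
    rw [cartan_apply_of_ne h hj.symm, zero_smul]
  have hl : ∀ i : Fin m, blockEquiv m (Sum.inl i.castSucc) = (idx (Sum.inl i)).castSucc :=
    fun i => blockEquiv_map (Sum.inl i)
  have hr : ∀ i : Fin m, blockEquiv m (Sum.inr i.castSucc) = (idx (Sum.inr i)).castSucc :=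
    fun i => blockEquiv_map (Sum.inr i)
  rw [matRep_reindex_apply, Finset.sum_congr rfl fun i _ => hoff i, Fintype.sum_sum_type,
    Fin.sum_univ_castSucc, Fin.sum_univ_castSucc]
  simp only [hl, hr, blockEquiv_inl_last, blockEquiv_inr_last, matOp_diag_monomial,
    matOp_last_monomial, apply_inr_inr, ← neg_smul, smul_smul, ← Finset.sum_smul,
    ← add_smul]
  congr 1
  simp only [monomialWeight, LinearMap.add_apply, LinearMap.sum_apply, LinearMap.smul_apply, eps_apply,
    smul_eq_mul]
  push_cast
  simp only [sub_mul, Finset.sum_sub_distrib, neg_mul, mul_neg, neg_neg, Finset.sum_neg_distrib,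
    mul_comm (h.1.1 _ _)]
  ring

variable {c : F} {S : Finset (Fin (2 * m + 1))}

theorem monomial_mem_weightSpace (s : Fin (2 * m + 1) →₀ ℕ) (b : F) :
    (monomial s b : MvPolynomial (Fin (2 * m + 1)) F) ∈
      (LieModule.weightSpace (OscModule c S (0 : Fin (2 * m + 1) → F))
        (monomialWeight c S s : cartan F m → F)).toSubmodule :=
  (LieModule.mem_weightSpace _ _).2 fun h => lie_monomial c S h s b

theorem monomialWeight_eq_of_mem_weightSpace {μ : Module.Dual F (cartan F m)}
    {f : MvPolynomial (Fin (2 * m + 1)) F}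
    (hf : f ∈ (LieModule.weightSpace (OscModule c S (0 : Fin (2 * m + 1) → F))
        (μ : cartan F m → F)).toSubmodule) {s : Fin (2 * m + 1) →₀ ℕ} (hs : s ∈ f.support) :
    monomialWeight c S s = μ := by
  ext h
  have h1 : matRep c S 0 (Matrix.reindex (blockEquiv m) (blockEquiv m) h.1.1) f = μ h • f :=
    (LieModule.mem_weightSpace _ _).1 hf h
  have h2 := coeff_of_monomial_eigenvector (fun s => lie_monomial c S h s 1) s f
  rw [h1, coeff_smul, smul_eq_mul] at h2
  exact (mul_right_cancel₀ (mem_support_iff.1 hs) h2).symm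

theorem monomialWeight_diagElt (d : Fin (m + 1) → F) (s : Fin (2 * m + 1) →₀ ℕ) :
    monomialWeight c S s (diagElt d) =
      ∑ i : Fin m, ((exponent S s (idx (Sum.inl i)) - exponent S s (idx (Sum.inr i)) : ℤ) : F) *
        d i.castSucc + (((exponent S s zIdx + ∑ j, exponent S s j : ℤ) : F) + c) *
          d (Fin.last m) := by
  simp [monomialWeight, eps_diagElt]

theorem exponent_sub_eq [CharZero F] {s t : Fin (2 * m + 1) →₀ ℕ}
    (h : monomialWeight c S s = monomialWeight c S t) (i : Fin m) :
    exponent S s (idx (Sum.inl i)) - exponent S s (idx (Sum.inr i)) =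
      exponent S t (idx (Sum.inl i)) - exponent S t (idx (Sum.inr i)) := by
  have h1 := LinearMap.congr_fun h (diagElt (Pi.single i.castSucc 1))
  have h2 : ∀ j : Fin m, (Pi.single i.castSucc 1 : Fin (m + 1) → F) j.castSucc =
      if j = i then 1 else 0 := fun j => by simp [Pi.single_apply]
  have h3 : (Pi.single i.castSucc 1 : Fin (m + 1) → F) (Fin.last m) = 0 := by
    simp [(Fin.castSucc_lt_last i).ne']
  simp only [monomialWeight_diagElt, h2, h3, mul_ite, mul_one, mul_zero, add_zero,
    Finset.sum_ite_eq', Finset.mem_univ, if_true] at h1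
  exact_mod_cast h1

theorem exponent_add_sum_eq [CharZero F] {s t : Fin (2 * m + 1) →₀ ℕ}
    (h : monomialWeight c S s = monomialWeight c S t) :
    exponent S s zIdx + ∑ j, exponent S s j = exponent S t zIdx + ∑ j, exponent S t j := by
  have h1 := LinearMap.congr_fun h (diagElt (Pi.single (Fin.last m) 1))
  have h2 : ∀ j : Fin m, (Pi.single (Fin.last m) 1 : Fin (m + 1) → F) j.castSucc = 0 :=
    fun j => by simp [(Fin.castSucc_lt_last j).ne]
  simp only [monomialWeight_diagElt, h2, Pi.single_eq_same, mul_zero, Finset.sum_const_zero,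
    zero_add, mul_one, add_left_inj] at h1
  exact_mod_cast h1

/-- The right side depends only on the weight. If one index of a pair is in `S`, the absolute
difference is `s_i + s_{i'} + 1`, and taken twice it compensates the negative exponent in the sum.
If both were in `S`, their degrees could grow with the difference fixed. -/
theorem degree_le_of_admissible (hS : Admissible S) (s : Fin (2 * m + 1) →₀ ℕ) :
    (s.degree : ℤ) ≤ exponent S s zIdx + ∑ j, exponent S s j +
      2 * ∑ i : Fin m, |exponent S s (idx (Sum.inl i)) - exponent S s (idx (Sum.inr i))| := by
  have hz : exponent S s zIdx = s zIdx := if_neg hS.1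
  rw [Finsupp.degree_eq_sum, sum_split, sum_split, hz]
  push_cast
  have h : ∀ i : Fin m, (s (idx (Sum.inl i)) + s (idx (Sum.inr i)) : ℤ) ≤
      (exponent S s (idx (Sum.inl i)) + exponent S s (idx (Sum.inr i))) +
      2 * |exponent S s (idx (Sum.inl i)) - exponent S s (idx (Sum.inr i))| := by
    intro i
    have h1 := le_abs_self (exponent S s (idx (Sum.inl i)) - exponent S s (idx (Sum.inr i)))
    have h2 := neg_le_abs (exponent S s (idx (Sum.inl i)) - exponent S s (idx (Sum.inr i)))
    have h3 : ¬(idx (Sum.inl i) ∈ S ∧ idx (Sum.inr i) ∈ S) := hS.2 i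
    generalize |exponent S s (idx (Sum.inl i)) - exponent S s (idx (Sum.inr i))| = k at *
    unfold exponent at *
    split_ifs at * <;> first | omega | tauto
  have hsum := Finset.sum_le_sum fun i (_ : i ∈ Finset.univ) => h i
  rw [Finset.sum_add_distrib (g := fun i => 2 * |_|), ← Finset.mul_sum] at hsum
  linarith [Int.natCast_nonneg (s zIdx)]

theorem exists_degree_le [CharZero F] (hS : Admissible S) (μ : Module.Dual F (cartan F m)) :
    ∃ B : ℕ, ∀ s : Fin (2 * m + 1) →₀ ℕ, monomialWeight c S s = μ → s.degree ≤ B := by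
  by_cases h : ∃ t, monomialWeight c S t = μ
  · obtain ⟨t, rfl⟩ := h
    refine ⟨(exponent S t zIdx + ∑ j, exponent S t j + 2 * ∑ i : Fin m,
      |exponent S t (idx (Sum.inl i)) - exponent S t (idx (Sum.inr i))|).toNat, fun s hs => ?_⟩
    have h1 := degree_le_of_admissible hS s
    rw [exponent_add_sum_eq hs, Finset.sum_congr rfl fun i _ =>
      congrArg abs (exponent_sub_eq hs i)] at h1
    omega
  · exact ⟨0, fun s hs => absurd ⟨s, hs⟩ h⟩

theorem finiteDimensional_weightSpace [CharZero F] (hS : Admissible S)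
    (μ : Module.Dual F (cartan F m)) :
    FiniteDimensional F (LieModule.weightSpace (OscModule c S (0 : Fin (2 * m + 1) → F))
      (μ : cartan F m → F)) := by
  obtain ⟨B, hB⟩ := exists_degree_le (c := c) hS μ
  let W : Submodule F (MvPolynomial (Fin (2 * m + 1)) F) :=
    (LieModule.weightSpace (OscModule c S (0 : Fin (2 * m + 1) → F))
      (μ : cartan F m → F)).toSubmodule
  have hW : W ≤ restrictTotalDegree (Fin (2 * m + 1)) F B := fun f hf =>
    (mem_restrictTotalDegree _ _ _).2 (Finset.sup_le fun s hs =>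
      hB s (monomialWeight_eq_of_mem_weightSpace hf hs))
  exact (Submodule.finiteDimensional_of_le hW : FiniteDimensional F W)

theorem not_finiteDimensional (a : Fin (2 * m + 1) → F) :
    ¬FiniteDimensional F (OscModule c S a) := by
  intro h
  have h' : Module.Finite F (MvPolynomial (Fin (2 * m + 1)) F) := h
  have := Module.Finite.finite_basis (basisMonomials (Fin (2 * m + 1)) F)
  exact not_finite (Fin (2 * m + 1) →₀ ℕ)

theorem cartan_lie_eq_zero (x y : cartan F m) : ⁅x, y⁆ = 0 := by
  apply Subtype.ext
  apply Subtype.ext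
  change x.1.1 * y.1.1 - y.1.1 * x.1.1 = 0
  rw [← Matrix.IsDiag.diagonal_diag x.2, ← Matrix.IsDiag.diagonal_diag y.2,
    Matrix.diagonal_mul_diagonal, Matrix.diagonal_mul_diagonal, sub_eq_zero]
  exact congrArg _ (funext fun i => mul_comm _ _)

instance : IsLieAbelian (cartan F m) := ⟨cartan_lie_eq_zero⟩

theorem eq_top_of_monomial_mem {a : Fin (2 * m + 1) → F} {W : Submodule F (OscModule c S a)}
    (h : ∀ s, (monomial s 1 : MvPolynomial (Fin (2 * m + 1)) F) ∈ W) : W = ⊤ :=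
  Submodule.eq_top_iff'.2 fun f =>
    mem_of_forall_monomial_mem (N := polys W) (f := f) fun s _ => h s

theorem isWeightModule :
    IsWeightModule F m (OscModule c S (0 : Fin (2 * m + 1) → F)) := by
  constructor
  -- Independence is inherited from the generalized weight spaces of the abelian Cartan subalgebra.
  · have h := LieModule.iSupIndep_genWeightSpace F (cartan F m)
      (OscModule c S (0 : Fin (2 * m + 1) → F))
    rw [← LieSubmodule.iSupIndep_toSubmodule] at h
    exact (h.comp (f := fun μ : Module.Dual F (cartan F m) => (μ : cartan F m → F))
      DFunLike.coe_injective).mono fun μ => LieModule.weightSpace_le_genWeightSpace _ _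
  · refine eq_top_of_monomial_mem fun s => ?_
    exact le_iSup (fun μ : Module.Dual F (cartan F m) =>
      (LieModule.weightSpace (OscModule c S (0 : Fin (2 * m + 1) → F))
        (μ : cartan F m → F)).toSubmodule) (monomialWeight c S s) (monomial_mem_weightSpace s 1)

end WeightModules

/-! ### Positive root vectors are strictly triangular -/

section RootVectors

variable {F : Type*} [Field F] {m : ℕ}

/-- The value on the weight of the `i`-th basis vector of the coweight that takes the value
`m + 2 - i` on `δ_i`. -/
def height : Fin (m + 1) ⊕ Fin (m + 1) → ℤ :=
  Sum.elim (fun i => if i = Fin.last m then -(m + 1) else i + 1)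
    (fun i => if i = Fin.last m then m + 1 else -(i + 1))

theorem height_le (i : Fin (m + 1) ⊕ Fin (m + 1)) : height i ≤ height (Sum.inr (Fin.last m)) := by
  rcases i with i | i <;> simp only [height, Sum.elim_inl, Sum.elim_inr, if_true] <;>
    split_ifs <;> omega

variable (F m) in
/-- The diagonal matrix with entries `height`. -/
def heightElt : cartan F m := diagElt fun i => ((height (Sum.inl i) : ℤ) : F)

theorem heightElt_apply (i : Fin (m + 1) ⊕ Fin (m + 1)) :
    (heightElt F m).1.1 i i = (height i : F) := by
  rcases i with i | i
  · simp [heightElt, diagElt]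
  · simp only [heightElt, diagElt, Matrix.diagonal_apply_eq, Sum.elim_inr, Pi.neg_apply, height,
      Sum.elim_inl]
    split_ifs <;> push_cast <;> ring

theorem del_heightElt (i : Fin (m + 1)) : del F i (heightElt F m) = ((m + 1 - i.1 : ℕ) : F) := by
  have h : ∀ i, eps F i (heightElt F m) = (height (Sum.inl i) : F) := fun i => eps_diagElt _ i
  unfold del
  split_ifs with h0
  · rw [LinearMap.neg_apply, h, h0]
    simp [height]
  · rw [h, height, Sum.elim_inl, if_neg]
    · have : i.1 ≠ 0 := fun e => h0 (Fin.ext e)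
      rw [show ((m + 1 - i.1 : ℕ) : F) = (((m + 1 - i.1 : ℕ) : ℤ) : F) by push_cast; rfl]
      congr 1
      rw [Fin.val_rev]
      omega
    · exact fun e => h0 (by rw [← Fin.rev_rev i, e, Fin.rev_last])

theorem IsPositiveRoot.heightElt_eq {α : Module.Dual F (cartan F m)} (h : IsPositiveRoot α) :
    ∃ k : ℕ, 0 < k ∧ α (heightElt F m) = k := by
  obtain ⟨i, j, ⟨hij, rfl⟩ | ⟨hij, rfl⟩⟩ := h
  · refine ⟨j.1 - i.1, by omega, ?_⟩
    rw [LinearMap.sub_apply, del_heightElt, del_heightElt, sub_eq_iff_eq_add,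
      ← Nat.cast_add]
    congr 1
    omega
  · refine ⟨(m + 1 - i.1) + (m + 1 - j.1), by omega, ?_⟩
    rw [LinearMap.add_apply, del_heightElt, del_heightElt]
    norm_cast

/-- The root vectors of positive roots are strictly triangular with respect to `height`. -/
theorem apply_eq_zero_of_isPositiveRoot [CharZero F] {α : Module.Dual F (cartan F m)}
    (h : IsPositiveRoot α) {A : Sp F m}
    (hA : A ∈ LieModule.weightSpace (Sp F m) (α : cartan F m → F))
    {i j : Fin (m + 1) ⊕ Fin (m + 1)} (hij : height i ≤ height j) : A.1 i j = 0 := by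
  obtain ⟨k, hk, hα⟩ := h.heightElt_eq
  have h1 := (LieModule.mem_weightSpace _ _).1 hA (heightElt F m)
  have h2 : ((heightElt F m).1.1 * A.1 - A.1 * (heightElt F m).1.1) i j =
      α (heightElt F m) * A.1 i j :=
    congrFun (congrFun (congrArg Subtype.val h1) i) j
  rw [← Matrix.IsDiag.diagonal_diag (heightElt F m).2, Matrix.sub_apply, Matrix.diagonal_mul,
    Matrix.mul_diagonal, Matrix.diag_apply, Matrix.diag_apply, heightElt_apply, heightElt_apply,
    hα] at h2
  -- The bracket with `heightElt` scales the entry `(i, j)` by `height i - height j`, which must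
  -- equal `k > 0` if the entry is nonzero.
  have h3 : ((height i - height j - k : ℤ) : F) * A.1 i j = 0 := by
    push_cast
    linear_combination h2
  refine (mul_eq_zero.1 h3).resolve_left ?_
  exact_mod_cast (by omega : height i - height j - k ≠ 0)

theorem matRep_mem_of_isPositiveRoot [CharZero F] {c : F} {S : Finset (Fin (2 * m + 1))}
    {a : Fin (2 * m + 1) → F} {α : Module.Dual F (cartan F m)}
    (h : IsPositiveRoot α) {A : Sp F m}
    (hA : A ∈ LieModule.weightSpace (Sp F m) (α : cartan F m → F))
    {W : Submodule F (MvPolynomial (Fin (2 * m + 1)) F)} {f : MvPolynomial (Fin (2 * m + 1)) F}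
    (hf : ∀ i j, height j < height i → matOp c S a (blockEquiv m i) (blockEquiv m j) f ∈ W) :
    matRep c S a (Matrix.reindex (blockEquiv m) (blockEquiv m) A.1) f ∈ W := by
  rw [matRep_reindex_apply]
  refine W.sum_mem fun i _ => W.sum_mem fun j _ => ?_
  rcases le_or_gt (height i) (height j) with hij | hij
  · rw [apply_eq_zero_of_isPositiveRoot h hA hij, zero_smul]
    exact W.zero_mem
  · exact W.smul_mem _ (hf i j hij)

/-- The column `j` of a strictly triangular matrix is zero or `j` is one of the indices
`1, …, 2m+1`. -/
theorem exists_castSucc_of_height_lt {i j : Fin (m + 1) ⊕ Fin (m + 1)}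
    (hij : height j < height i) : ∃ k, blockEquiv m j = Fin.castSucc k := by
  rcases Fin.eq_castSucc_or_eq_last (blockEquiv m j) with h | h
  · exact h
  · rw [← blockEquiv_inr_last, EmbeddingLike.apply_eq_iff_eq] at h
    exact absurd (height_le i) (by rw [← h]; omega)

end RootVectors

/-! ### Highest-weight vectors and the composition factors -/

section HighestWeight

variable {F : Type*} [Field F] {m : ℕ} {c : F}

theorem lieSpan_eq_top_of_isIrreducible {M : Type*} [AddCommGroup M] [Module F M]
    [LieRingModule (Sp F m) M] [LieModule F (Sp F m) M] (h : LieModule.IsIrreducible F (Sp F m) M)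
    {v : M} (hv : v ≠ 0) : LieSubmodule.lieSpan F (Sp F m) {v} = ⊤ := by
  refine (h.eq_bot_or_eq_top _).resolve_left fun e => hv ?_
  have h1 : v ∈ LieSubmodule.lieSpan F (Sp F m) {v} := LieSubmodule.subset_lieSpan rfl
  rwa [e, LieSubmodule.mem_bot] at h1

theorem exists_mem_ne_zero_of_ne_bot {M : Type*} [AddCommGroup M] [Module F M]
    [LieRingModule (Sp F m) M] {N : LieSubmodule F (Sp F m) M} (h : N ≠ ⊥) :
    ∃ v ∈ N, v ≠ 0 := by
  by_contra! hall
  exact h ((LieSubmodule.eq_bot_iff N).2 hall)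

theorem del_zero : del F (0 : Fin (m + 1)) = -eps F (Fin.last m) := by
  simp [del]

theorem fundWeight_zero : fundWeight F (0 : Fin (m + 1)) = -eps F (Fin.last m) := by
  have : Finset.Iic (0 : Fin (m + 1)) = {0} := by
    ext i; simp
  rw [fundWeight, this, Finset.sum_singleton, del_zero]

theorem monomialWeight_zero :
    monomialWeight c ∅ (0 : Fin (2 * m + 1) →₀ ℕ) = -c • fundWeight F 0 := by
  simp [monomialWeight, exponent, fundWeight_zero]

/-- The last index has the greatest height, so it is never the column of a positive matrix unit; the
right factor is therefore a derivative and kills `1`. -/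
theorem matOp_one_eq_zero {i j : Fin (m + 1) ⊕ Fin (m + 1)} (hij : height j < height i) :
    matOp c ∅ (0 : Fin (2 * m + 1) → F) (blockEquiv m i) (blockEquiv m j) 1 = 0 := by
  obtain ⟨k, hk⟩ := exists_castSucc_of_height_lt hij
  rw [hk, matOp, rightOp, Fin.snoc_castSucc, Module.End.mul_apply, momOp_empty, pderiv_one,
    map_zero]

theorem isHighestWeightModule_empty [CharZero F]
    (h : LieModule.IsIrreducible F (Sp F m) (OscModule c ∅ (0 : Fin (2 * m + 1) → F))) :
    IsHighestWeightModule F m (OscModule c ∅ (0 : Fin (2 * m + 1) → F))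
      (-c • fundWeight F 0) := by
  have h1 : (1 : MvPolynomial (Fin (2 * m + 1)) F) ≠ 0 := one_ne_zero
  refine ⟨(1 : MvPolynomial (Fin (2 * m + 1)) F), h1, ?_, fun α hα A hA => ?_,
    lieSpan_eq_top_of_isIrreducible h h1⟩
  · rw [← monomialWeight_zero]
    exact monomial_mem_weightSpace 0 1
  · exact (Submodule.mem_bot F).1 (matRep_mem_of_isPositiveRoot hα hA (W := ⊥)
      fun i j hij => (Submodule.mem_bot F).2 (matOp_one_eq_zero hij))

variable {l : ℕ}

theorem matOp_mem_restrictTotalDegree (i j : Fin (2 * m + 1 + 1))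
    {f : MvPolynomial (Fin (2 * m + 1)) F} (hf : f ∈ restrictTotalDegree (Fin (2 * m + 1)) F l) :
    matOp (-(l : F)) ∅ 0 i j f ∈ restrictTotalDegree (Fin (2 * m + 1)) F l := by
  refine mem_of_forall_monomial_mem
    (N := (restrictTotalDegree (Fin (2 * m + 1)) F l).comap (matOp (-(l : F)) ∅ 0 i j))
    fun s hs => ?_
  replace hs := hs.trans ((mem_restrictTotalDegree _ _ _).1 hf)
  have hs' : (monomial s (1 : F)).totalDegree ≤ l :=
    (totalDegree_monomial s one_ne_zero).trans_le hs
  change matOp (-(l : F)) ∅ 0 i j (monomial s 1) ∈ restrictTotalDegree (Fin (2 * m + 1)) F l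
  rw [mem_restrictTotalDegree, matOp, leftOp, rightOp, Module.End.mul_apply]
  refine Fin.lastCases ?_ (fun j => ?_) j
  · have h1 : Fin.snoc (α := fun _ => Module.End F (MvPolynomial (Fin (2 * m + 1)) F))
        (momOp ∅ 0) (eulerOp ∅ 0 + -(l : F) • 1) (Fin.last (2 * m + 1)) (monomial s 1) =
        ((s.degree : F) + -(l : F)) • monomial s 1 := by
      rw [Fin.snoc_last, ← shiftedEuler_empty_monomial]
      rfl
    rw [h1, map_smul]
    refine Fin.lastCases ?_ (fun i => ?_) i
    · rw [Fin.snoc_last]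
      refine (totalDegree_smul_le _ _).trans ?_
      rw [LinearMap.neg_apply, totalDegree_neg]
      exact hs'
    · rw [Fin.snoc_castSucc, posOp_empty]
      -- Only `x_i (D + c)` could leave degree at most `l`, and in degree exactly `l` its factor `D
      -- - l` vanishes.
      rcases hs.eq_or_lt with h2 | h2
      · simp [h2]
      · exact (totalDegree_smul_le _ _).trans (totalDegree_X_mul_le i
          ((totalDegree_monomial s one_ne_zero).trans_le (Nat.le_sub_one_of_lt h2)) |>.trans
            (by omega))
  · rw [Fin.snoc_castSucc, momOp_empty]
    refine Fin.lastCases ?_ (fun i => ?_) i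
    · rw [Fin.snoc_last, LinearMap.neg_apply, totalDegree_neg]
      exact totalDegree_pderiv_le (hs'.trans (Nat.le_succ l))
    · rw [Fin.snoc_castSucc, posOp_empty]
      by_cases h0 : pderiv j (monomial s (1 : F)) = 0
      · simp [h0]
      · have := totalDegree_pderiv_lt h0
        exact (totalDegree_X_mul_le i (Nat.le_sub_one_of_lt this)).trans (by omega)

theorem matRep_mem_restrictTotalDegree
    (A : Matrix (Fin (m + 1) ⊕ Fin (m + 1)) (Fin (m + 1) ⊕ Fin (m + 1)) F)
    {f : MvPolynomial (Fin (2 * m + 1)) F} (hf : f ∈ restrictTotalDegree (Fin (2 * m + 1)) F l) :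
    matRep (-(l : F)) ∅ 0 (Matrix.reindex (blockEquiv m) (blockEquiv m) A) f ∈
      restrictTotalDegree (Fin (2 * m + 1)) F l := by
  rw [matRep_reindex_apply]
  exact Submodule.sum_mem _ fun i _ => Submodule.sum_mem _ fun j _ =>
    Submodule.smul_mem _ _ (matOp_mem_restrictTotalDegree _ _ hf)

variable (F m l) in
/-- The submodule of polynomials of degree at most `l`, if `c = -l`. -/
noncomputable def degreeLE :
    LieSubmodule F (Sp F m) (OscModule (-(l : F)) ∅ (0 : Fin (2 * m + 1) → F)) where
  toSubmodule := restrictTotalDegree (Fin (2 * m + 1)) F l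
  lie_mem := fun hf => matRep_mem_restrictTotalDegree _ hf

theorem mem_degreeLE {f : MvPolynomial (Fin (2 * m + 1)) F} :
    f ∈ (degreeLE F m l).toSubmodule ↔ f.totalDegree ≤ l :=
  mem_restrictTotalDegree _ _ _

instance : FiniteDimensional F (degreeLE F m l) :=
  inferInstanceAs (FiniteDimensional F (restrictTotalDegree (Fin (2 * m + 1)) F l))

variable (F m l) in
/-- The constant polynomial `1`. -/
noncomputable def degreeLEOne : degreeLE F m l :=
  ⟨(1 : MvPolynomial (Fin (2 * m + 1)) F), mem_degreeLE.2 (by simp)⟩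

theorem degreeLEOne_ne_zero : degreeLEOne F m l ≠ 0 := fun h =>
  one_ne_zero (α := MvPolynomial (Fin (2 * m + 1)) F) (congrArg Subtype.val h)

theorem isIrreducible_degreeLE [CharZero F] :
    LieModule.IsIrreducible F (Sp F m) (degreeLE F m l) := by
  have : Nontrivial (degreeLE F m l) := ⟨⟨_, _, degreeLEOne_ne_zero⟩⟩
  refine LieModule.IsIrreducible.mk fun N hN => ?_
  have hmap : IsInvariant (-(l : F)) ∅ 0 (polys (N.map (degreeLE F m l).incl).toSubmodule) :=
    isInvariant_polys _
  obtain ⟨⟨f, hf⟩, hfN, hf0⟩ := exists_mem_ne_zero_of_ne_bot hN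
  have h0 : polys (N.map (degreeLE F m l).incl).toSubmodule ≠ ⊥ := fun e =>
    hf0 (Subtype.ext ((Submodule.mem_bot F).1 (e ▸ ⟨⟨f, hf⟩, hfN, rfl⟩)))
  rw [eq_top_iff]
  rintro ⟨g, hg⟩ -
  obtain ⟨g', hg', e⟩ := hmap.mem_of_totalDegree_le h0 (mem_degreeLE.1 hg)
  rwa [show g' = ⟨g, hg⟩ from Subtype.ext e] at hg'

theorem isHighestWeightModule_degreeLE [CharZero F] :
    IsHighestWeightModule F m (degreeLE F m l) ((l : F) • fundWeight F 0) := by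
  refine ⟨degreeLEOne F m l, degreeLEOne_ne_zero, ?_, fun α hα A hA => ?_,
    lieSpan_eq_top_of_isIrreducible isIrreducible_degreeLE degreeLEOne_ne_zero⟩
  · refine (LieModule.mem_weightSpace _ _).2 fun h => Subtype.ext ?_
    have h1 := lie_monomial (-(l : F)) ∅ h 0 1
    rw [monomialWeight_zero, neg_neg] at h1
    exact h1
  · exact Subtype.ext ((Submodule.mem_bot F).1 (matRep_mem_of_isPositiveRoot hα hA (W := ⊥)
      fun i j hij => (Submodule.mem_bot F).2 (matOp_one_eq_zero hij)))

/-- The exponent of the highest-weight vector of the quotient by `degreeLE F m l`. -/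
noncomputable def topExponent (hm : 1 ≤ m) (l : ℕ) : Fin (2 * m + 1) →₀ ℕ :=
  Finsupp.single (idx (Sum.inl ⟨m - 1, by omega⟩)) (l + 1)

variable (F) in
/-- The highest-weight vector of the quotient by `degreeLE F m l`. -/
noncomputable def quotientVector (hm : 1 ≤ m) (l : ℕ) :
    OscModule (-(l : F)) ∅ (0 : Fin (2 * m + 1) → F) ⧸ degreeLE F m l :=
  LieSubmodule.Quotient.mk (N := degreeLE F m l)
    (monomial (topExponent hm l) 1 : MvPolynomial (Fin (2 * m + 1)) F)

theorem quotientVector_ne_zero (hm : 1 ≤ m) : quotientVector F hm l ≠ 0 := by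
  intro h
  have h1 := mem_degreeLE.1 ((LieSubmodule.Quotient.mk_eq_zero (N := degreeLE F m l)).1 h)
  rw [totalDegree_monomial _ one_ne_zero, topExponent, Finsupp.sum_single_index rfl] at h1
  omega

/-- The preimage of a nonzero submodule contains all polynomials of degree at most `l` and one of
greater degree, hence is everything. -/
theorem isIrreducible_quotient [CharZero F] (hm : 1 ≤ m) : LieModule.IsIrreducible F (Sp F m)
    (OscModule (-(l : F)) ∅ (0 : Fin (2 * m + 1) → F) ⧸ degreeLE F m l) := by
  have : Nontrivial (OscModule (-(l : F)) ∅ (0 : Fin (2 * m + 1) → F) ⧸ degreeLE F m l) :=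
    ⟨⟨_, _, quotientVector_ne_zero hm⟩⟩
  refine LieModule.IsIrreducible.mk fun N hN => ?_
  have hinv : IsInvariant (-(l : F)) ∅ 0
      (polys (N.comap (LieSubmodule.Quotient.mk' (degreeLE F m l))).toSubmodule) :=
    isInvariant_polys _
  obtain ⟨q, hq, hq0⟩ := exists_mem_ne_zero_of_ne_bot hN
  obtain ⟨f, rfl⟩ := LieSubmodule.Quotient.surjective_mk' (degreeLE F m l) q
  have htop := hinv.eq_top_of_lt_totalDegree hm (fun g hg => ?_) (f := f) hq ?_
  · rw [eq_top_iff]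
    rintro q' -
    obtain ⟨g, rfl⟩ := LieSubmodule.Quotient.surjective_mk' (degreeLE F m l) q'
    have hg : g ∈ polys (N.comap (LieSubmodule.Quotient.mk' (degreeLE F m l))).toSubmodule := by
      rw [htop]; trivial
    exact hg
  · change LieSubmodule.Quotient.mk' (degreeLE F m l) g ∈ N
    rw [(LieSubmodule.Quotient.mk_eq_zero (N := degreeLE F m l)).2 (mem_degreeLE.2 hg)]
    exact N.zero_mem
  · by_contra! hle
    exact hq0 ((LieSubmodule.Quotient.mk_eq_zero (N := degreeLE F m l)).2 (mem_degreeLE.2 hle))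

theorem fundWeight_one (hm : 1 ≤ m) : fundWeight F (1 : Fin (m + 1)) =
    -eps F (Fin.last m) + eps F (Fin.castSucc ⟨m - 1, by omega⟩) := by
  obtain ⟨m, rfl⟩ : ∃ k, m = k + 1 := ⟨m - 1, by omega⟩
  have : Finset.Iic (1 : Fin (m + 1 + 1)) = {0, 1} := by
    ext i
    simp only [Finset.mem_Iic, Finset.mem_insert, Finset.mem_singleton, Fin.le_def, Fin.ext_iff,
      Fin.val_one, Fin.val_zero]
    omega
  rw [fundWeight, this, Finset.sum_pair (by simp), del_zero, del, if_neg (by simp)]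
  congr 2

/-- In `x_m^(l+1)` the coefficient of `ε_{m+1}` is `(l + 1) - l = 1`, so the weight is `(l + 1) δ_2
- δ_1`. -/
theorem monomialWeight_topExponent (hm : 1 ≤ m) :
    monomialWeight (-(l : F)) ∅ (topExponent hm l) =
      -((l : F) + 2) • fundWeight F 0 + ((l : F) + 1) • fundWeight F 1 := by
  have h1 : ∀ i, exponent ∅ (topExponent hm l) i =
      if i = idx (Sum.inl ⟨m - 1, by omega⟩) then (l + 1 : ℤ) else 0 := by
    intro i
    simp only [exponent, Finset.notMem_empty, if_false, topExponent, Finsupp.single_apply, eq_comm]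
    split_ifs <;> simp
  rw [monomialWeight, Finset.sum_eq_single (⟨m - 1, by omega⟩ : Fin m) ?_ (by simp)]
  · rw [fundWeight_zero, fundWeight_one hm, Finset.sum_congr rfl fun i _ => h1 i, h1, h1, h1,
      if_pos rfl, if_neg fun e => by simpa using idx_injective e, if_neg (idx_ne_zIdx _).symm,
      Finset.sum_ite_eq', if_pos (Finset.mem_univ _)]
    push_cast
    module
  · intro i _ hi
    rw [h1, h1, if_neg fun e => hi (by simpa using idx_injective e),
      if_neg fun e => by simpa using idx_injective e]
    simp

theorem isHighestWeightModule_quotient [CharZero F] (hm : 1 ≤ m) :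
    IsHighestWeightModule F m
      (OscModule (-(l : F)) ∅ (0 : Fin (2 * m + 1) → F) ⧸ degreeLE F m l)
      (-((l : F) + 2) • fundWeight F 0 + ((l : F) + 1) • fundWeight F 1) := by
  refine ⟨quotientVector F hm l, quotientVector_ne_zero hm, ?_, fun α hα A hA => ?_,
    lieSpan_eq_top_of_isIrreducible (isIrreducible_quotient hm) (quotientVector_ne_zero hm)⟩
  · refine (LieModule.mem_weightSpace _ _).2 fun h => ?_
    have h1 := lie_monomial (-(l : F)) ∅ h (topExponent hm l) 1
    rw [monomialWeight_topExponent] at h1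
    exact congrArg (LieSubmodule.Quotient.mk (N := degreeLE F m l)) h1
  · refine (LieSubmodule.Quotient.mk_eq_zero (N := degreeLE F m l)).2
      (matRep_mem_of_isPositiveRoot hα hA (W := restrictTotalDegree (Fin (2 * m + 1)) F l)
        fun i j hij => ?_)
    obtain ⟨k, hk⟩ := exists_castSucc_of_height_lt hij
    rw [hk, matOp, rightOp, Fin.snoc_castSucc, Module.End.mul_apply, momOp_empty]
    -- Only `∂_{x_m}` does not kill `x_m^(l+1)`. As `x_m` has the second greatest height, the row
    -- must be the last one, so the operator is `-∂_{x_m}` itself and lands in degree `l`, zero in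
    -- the quotient.
    by_cases hkt : k = idx (Sum.inl ⟨m - 1, by omega⟩)
    · have hi : i = Sum.inr (Fin.last m) := by
        have hj : j = Sum.inl (Fin.castSucc ⟨m - 1, by omega⟩) := by
          apply (blockEquiv m).injective
          rw [hk, hkt]
          exact (blockEquiv_map (Sum.inl _)).symm
        rw [hj] at hij
        rcases i with i | i <;> simp only [height, Sum.elim_inl, Sum.elim_inr, Fin.ext_iff,
          Fin.val_castSucc, Fin.val_last] at hij
        · split_ifs at hij <;> omega
        · split_ifs at hij with h1 h2 h3
          · omega
          · omega
          · exact congrArg Sum.inr (Fin.ext h3)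
          · omega
      rw [hi, blockEquiv_inr_last, leftOp, Fin.snoc_last, LinearMap.neg_apply, mem_restrictTotalDegree,
        totalDegree_neg]
      refine totalDegree_pderiv_le ((totalDegree_monomial _ one_ne_zero).trans_le ?_)
      rw [topExponent, Finsupp.sum_single_index rfl]
    · rw [pderiv_monomial, topExponent, Finsupp.single_eq_of_ne hkt]
      simp

end HighestWeight

end ProjOsc

open ProjOsc in
theorem theorem2 {F : Type*} [Field F] [CharZero F] {m : ℕ} (hm : 1 ≤ m)
    (S : Finset (Fin (2 * m + 1))) (hS : Admissible S) :
    -- `S = ∅`, `a = 0`, `c ∉ -ℕ`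
    (∀ c : F, (∀ k : ℕ, c ≠ -(k : F)) →
      LieModule.IsIrreducible F (Sp F m) (OscModule c ∅ (0 : Fin (2 * m + 1) → F)) ∧
      IsHighestWeightModule F m (OscModule c ∅ (0 : Fin (2 * m + 1) → F)) (-c • fundWeight F 0)) ∧
    -- `S = ∅`, `a = 0`, `c = -ℓ ∈ -ℕ`: the composition series `0 ⊂ N ⊂ A`
    (∀ ℓ : ℕ, ∃ N : LieSubmodule F (Sp F m) (OscModule (-(ℓ : F)) ∅ (0 : Fin (2 * m + 1) → F)),
      N.toSubmodule = MvPolynomial.restrictTotalDegree (Fin (2 * m + 1)) F ℓ ∧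
      FiniteDimensional F N ∧
      LieModule.IsIrreducible F (Sp F m) N ∧
      IsHighestWeightModule F m N ((ℓ : F) • fundWeight F 0) ∧
      LieModule.IsIrreducible F (Sp F m)
        (OscModule (-(ℓ : F)) ∅ (0 : Fin (2 * m + 1) → F) ⧸ N) ∧
      IsHighestWeightModule F m (OscModule (-(ℓ : F)) ∅ (0 : Fin (2 * m + 1) → F) ⧸ N)
        (-((ℓ : F) + 2) • fundWeight F 0 + ((ℓ : F) + 1) • fundWeight F 1)) ∧
    -- `S ≠ ∅`, `a = 0`, `c ∉ ℤ`
    (S.Nonempty → ∀ c : F, (∀ k : ℤ, c ≠ (k : F)) →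
      LieModule.IsIrreducible F (Sp F m) (OscModule c S (0 : Fin (2 * m + 1) → F))) ∧
    -- `a ≠ 0`
    (∀ a : Fin (2 * m + 1) → F, a ≠ 0 → a (xIdx (Fin.last m)) = 0 →
      ((∃ i : Fin m, yIdx i ∈ S) → ∃ i : Fin m, yIdx i ∈ S ∧ a (xIdx i.castSucc) ≠ 0) →
      ((∃ j : Fin m, xIdx j.castSucc ∈ S) →
        ∃ j : Fin m, xIdx j.castSucc ∈ S ∧ a (yIdx j) ≠ 0) →
      ∀ c : F, LieModule.IsIrreducible F (Sp F m) (OscModule c S a)) ∧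
    -- `a = 0`: weight modules
    (∀ c : F, IsWeightModule F m (OscModule c S (0 : Fin (2 * m + 1) → F)) ∧
      ¬ FiniteDimensional F (OscModule c S (0 : Fin (2 * m + 1) → F)) ∧
      ∀ μ : Module.Dual F (cartan F m), FiniteDimensional F
        (LieModule.weightSpace (OscModule c S (0 : Fin (2 * m + 1) → F))
          (μ : cartan F m → F))) := by
  refine ⟨fun c hc => ?_, fun ℓ => ?_, fun hne c hc => isIrreducible_of_notMem_int hm hS hc,
    fun a ha hz hy hx c => isIrreducible_of_ne_zero hm hS ha hz hy hx,
    fun c => ⟨isWeightModule, not_finiteDimensional 0, finiteDimensional_weightSpace hS⟩⟩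
  · have h := isIrreducible_empty hm hc
    exact ⟨h, isHighestWeightModule_empty h⟩
  · exact ⟨degreeLE F m ℓ, rfl, inferInstance, isIrreducible_degreeLE,
      isHighestWeightModule_degreeLE, isIrreducible_quotient hm, isHighestWeightModule_quotient hm⟩
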